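/- \textbf{Theorem (Tangential traces for $\mathscr{CM}^\infty$-fields).} Let $\Omega\subset\mathbb R^3$ be open and bounded, and let $\Omega'\Subset\Omega$ (that is, $\overline{\Omega'}\subset\Omega$) be open with Lipschitz boundary. Let $F\in\mathscr{CM}^\infty(\Omega)$; that is, $F\in L^\infty(\Omega;\mathbb R^3)$ and the distributional curl of $F$ is represented by a finite $\mathbb R^3$-valued Radon measure $\operatorname{curl}F$ on $\Omega$, in the sense that $\int_\Omega F\cdot\operatorname{curl}\Phi\,dx=\int_\Omega \Phi\cdot d(\operatorname{curl}F)$ for all $\Phi\in C_c^\infty(\Omega;\mathbb R^3)$. For scalar test functions $\varphi$, define the interior and exterior distributional tangential traces of $F$ on $\partial\Omega'$ by $$\langle (F\times\nu)^{\mathrm{int}}_{\Omega'},\varphi\rangle:=\int_{\Omega'}\varphi\,d(\operatorname{curl}F)-\int_{\Omega'}F\times\nabla\varphi\,dx,$$ $$\langle (F\times\nu)^{\mathrm{ext}}_{\Omega'},\varphi\rangle:=-\int_{\Omega\setminus\overline{\Omega'}}\varphi\,d(\operatorname{curl}F)+\int_{\Omega\setminus\overline{\Omega'}}F\times\nabla\varphi\,dx.$$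 Then there exist $t^{\mathrm{int}},t^{\mathrm{ext}}\in L^\infty(\partial\Omega';\mathbb R^3)$ (with respect to the Hausdorff measure $\mathscr H^2$) such that the following hold. 1. (Representation.) For every $\varphi\in C_c^1(\Omega)$, $$\int_{\partial\Omega'}\varphi\,t^{\mathrm{int}}\,d\mathscr H^2=\langle (F\times\nu)^{\mathrm{int}}_{\Omega'},\varphi\rangle,\qquad \int_{\partial\Omega'}\varphi\,t^{\mathrm{ext}}\,d\mathscr H^2=\langle (F\times\nu)^{\mathrm{ext}}_{\Omega'},\varphi\rangle.$$ 2. (Tangential character.) For $\mathscr H^2$-a.e. $x\in\partial\Omega'$, the surface $\partial\Omega'$ has a two-dimensional tangent space $T_{\partial\Omega'}(x)$ at $x$, and $t^{\mathrm{int}}(x)\in T_{\partial\Omega'}(x)$ and $t^{\mathrm{ext}}(x)\in T_{\partial\Omega'}(x)$. 3. (Vectorial version.) For every $\Phi\in C_c^1(\Omega;\mathbb R^3)$, $$\int_{\partial\Omega'}t^{\mathrm{int}}\cdot\Phi\,d\mathscr H^2=\int_{\Omega'}\Phi\cdot d(\operatorname{curl}F)-\int_{\Omega'}(\operatorname{curl}\Phi)\cdot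 F\,dx,$$ $$\int_{\partial\Omega'}t^{\mathrm{ext}}\cdot\Phi\,d\mathscr H^2=-\int_{\Omega\setminus\overline{\Omega'}}\Phi\cdot d(\operatorname{curl}F)+\int_{\Omega\setminus\overline{\Omega'}}(\operatorname{curl}\Phi)\cdot F\,dx.$$ -/

import Mathlib

open MeasureTheory Set Filter Topology
open scoped Distributions NNReal ENNReal RealInnerProductSpace

namespace CurlMeasure

/-- Three-dimensional Euclidean space. -/
abbrev R3 : Type := EuclideanSpace ℝ (Fin 3)

/-- The cross product `a × b` on `R3`. -/
noncomputable def cross (a b : R3) : R3 :=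
  WithLp.toLp 2 (crossProduct (WithLp.ofLp a) (WithLp.ofLp b))

/-- The partial derivative `∂ⱼ Φᵢ (x)` of a vector field `Φ`. -/
noncomputable def partialDeriv (j : Fin 3) (Φ : R3 → R3) (i : Fin 3) (x : R3) : ℝ :=
  (fderiv ℝ Φ x (EuclideanSpace.single j 1)) i

/-- The classical curl of a differentiable vector field. -/
noncomputable def curl (Φ : R3 → R3) (x : R3) : R3 :=
  !₂[partialDeriv 1 Φ 2 x - partialDeriv 2 Φ 1 x,
     partialDeriv 2 Φ 0 x - partialDeriv 0 Φ 2 x,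
     partialDeriv 0 Φ 1 x - partialDeriv 1 Φ 0 x]

/-- The Euclidean inner product as a continuous bilinear map, used to pair vector fields with
vector measures: `∫ᵛ x in s, Φ x ∂[innerB; μ]` is `∫_s Φ · dμ`. -/
noncomputable def innerB : R3 →L[ℝ] R3 →L[ℝ] ℝ := innerSL ℝ

/-- `HasCurlMeasure Ω F μ`: the distributional curl of `F` in `Ω` is represented by the finite
`ℝ³`-valued Borel (hence Radon) measure `μ`. Finite measures on `Ω` are viewed as measures on the
whole space; only the values of `μ` on Borel subsets of `Ω` play a role. -/
structure HasCurlMeasure (Ω : TopologicalSpace.Opens R3) (F : R3 → R3)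
    (μ : VectorMeasure R3 R3) : Prop where
  finite_variation : IsFiniteMeasure μ.variation
  integral_curl : ∀ Φ : 𝓓(Ω, R3),
    ∫ x in (Ω : Set R3), ⟪F x, curl Φ x⟫ = ∫ᵛ x in (Ω : Set R3), Φ x ∂[innerB; μ]

/-- `F` is a `p`-curl-measure field on `Ω`. -/
def IsCurlMeasureField (p : ℝ≥0∞) (Ω : TopologicalSpace.Opens R3) (F : R3 → R3) : Prop :=
  MemLp F p (volume.restrict (Ω : Set R3)) ∧ ∃ μ : VectorMeasure R3 R3, HasCurlMeasure Ω F μ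

/-- The interior distributional tangential trace of `F` on `∂U`, evaluated at a scalar test
function `φ`; here `μ` is the measure `curl F`. -/
noncomputable def interiorTrace (U : Set R3) (F : R3 → R3) (μ : VectorMeasure R3 R3)
    (φ : R3 → ℝ) : R3 :=
  (∫ᵛ x in U, φ x ∂•μ) - ∫ x in U, cross (F x) (gradient φ x)

/-- The exterior distributional tangential trace of `F` on `∂U`, evaluated at a scalar test
function `φ`; here `μ` is the measure `curl F`. -/
noncomputable def exteriorTrace (Ω : TopologicalSpace.Opens R3) (U : Set R3) (F : R3 → R3)
    (μ : VectorMeasure R3 R3) (φ : R3 → ℝ) : R3 :=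
  -(∫ᵛ x in (Ω : Set R3) \ closure U, φ x ∂•μ)
    + ∫ x in (Ω : Set R3) \ closure U, cross (F x) (gradient φ x)

/-- `U` has Lipschitz boundary: near each boundary point, in suitable Cartesian coordinates, `U` is
the set of points that lie strictly above the graph of a Lipschitz function. -/
def HasLipschitzBoundary (U : Set R3) : Prop :=
  ∀ x₀ ∈ frontier U, ∃ (R : R3 ≃ₗᵢ[ℝ] R3) (g : EuclideanSpace ℝ (Fin 2) → ℝ) (K : ℝ≥0),
    LipschitzWith K g ∧ ∀ᶠ x in 𝓝 x₀, (x ∈ U ↔ g !₂[R x 0, R x 1] < R x 2)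

/-- `T` is the (two-dimensional) tangent space of `S` at `x`: the tangent cone of `S` at `x` is the
plane `T`. -/
def IsTangentPlane (S : Set R3) (x : R3) (T : Submodule ℝ R3) : Prop :=
  Module.finrank ℝ T = 2 ∧ tangentConeAt ℝ S x = (T : Set R3)

end CurlMeasure

/-! Let V be `Ω'` or `Ω \ closure Ω'`, let S be the boundary of `Ω'`, and let B(Φ) = ∫_V Φ · d(curl
F) - ∫_V curl Φ · F be the pairing `boundaryForm`. It vanishes on test fields whose support misses
S, so everything happens near S.

The key estimate is `abs_boundaryForm_le_of_graph`. Near a boundary point V is the supergraph of a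
Lipschitz function g. Multiply Φ by a cutoff χ that vanishes outside V and rises to 1 across a thin
layer above the graph. The distributional curl identity gives B(χΦ) = 0, and by the Leibniz rule
what remains is ∫ F · (∇χ × Φ). Since ∇χ is parallel to the normal n and its size is the inverse of
the thickness, shrinking the layer bounds |B(Φ)| by a constant times ∫ |n × Φ| over the graph. As g
is only Lipschitz, the cutoffs follow mollified graphs, whose gradients are bounded and converge
almost everywhere.

This estimate is used twice. It bounds B by the L¹ norm on S; a partition of unity makes the bound
global, the Riesz theorem in L²(S) yields a density t, and the L¹ bound makes t essentially bounded
(`IsLipschitzSide.exists_density`). Moreover B sees only n × Φ, so t annihilates normal fields. The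
normal is merely measurable, so normal fields are reached by L¹ approximation
(`IsLipschitzSide.integral_inner_normal_eq_zero`). Rademacher's theorem identifies the orthogonal
complement of n with the tangent plane almost everywhere.

The scalar traces are the case Φ = φc with c a constant vector (`inner_scalarTrace`). -/

namespace CurlMeasure

/-! ### Algebra of the cross product and the curl -/

/-- The cross product as a continuous bilinear map. -/
noncomputable def crossL : R3 →L[ℝ] R3 →L[ℝ] R3 :=
  LinearMap.toContinuousBilinearMap
    ((crossProduct (R := ℝ)).compl₁₂ (WithLp.linearEquiv 2 ℝ (Fin 3 → ℝ)).toLinearMap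
      (WithLp.linearEquiv 2 ℝ (Fin 3 → ℝ)).toLinearMap |>.compr₂
        (WithLp.linearEquiv 2 ℝ (Fin 3 → ℝ)).symm.toLinearMap)

lemma crossL_apply (a b : R3) : crossL a b = cross a b := rfl

attribute [irreducible] crossL

lemma cross_self (a : R3) : cross a a = 0 := by
  simp [cross]

lemma cross_smul_right (c : ℝ) (a b : R3) : cross a (c • b) = c • cross a b := by
  simp [← crossL_apply]

lemma cross_smul_left (c : ℝ) (a b : R3) : cross (c • a) b = c • cross a b := by
  simp [← crossL_apply]

lemma norm_cross_le (a b : R3) : ‖cross a b‖ ≤ ‖crossL‖ * ‖a‖ * ‖b‖ :=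
  crossL_apply a b ▸ crossL.le_opNorm₂ a b

lemma inner_cross_left (a b c : R3) : ⟪cross a b, c⟫ = ⟪b, cross c a⟫ := by
  simp [cross, crossProduct, PiLp.inner_apply, Fin.sum_univ_three]
  ring

lemma _root_.Filter.Tendsto.cross {X : Type*} {l : Filter X} {f g : X → R3} {a b : R3}
    (hf : Tendsto f l (𝓝 a)) (hg : Tendsto g l (𝓝 b)) :
    Tendsto (fun x ↦ cross (f x) (g x)) l (𝓝 (cross a b)) := by
  have h : Tendsto (fun q : R3 × R3 ↦ crossL q.1 q.2) (𝓝 (a, b)) (𝓝 (crossL a b)) :=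
    crossL.continuous₂.tendsto (a, b)
  simp only [← crossL_apply]
  exact h.comp (hf.prodMk_nhds hg)

lemma _root_.Continuous.cross {X : Type*} [TopologicalSpace X] {f g : X → R3} (hf : Continuous f)
    (hg : Continuous g) : Continuous fun x ↦ cross (f x) (g x) :=
  continuous_iff_continuousAt.2 fun x ↦ (hf.tendsto x).cross (hg.tendsto x)

/-- The curl as a linear function of the derivative. -/
noncomputable def curlOp : (R3 →L[ℝ] R3) →L[ℝ] R3 :=
  LinearMap.toContinuousLinearMap
    { toFun := fun A ↦ ∑ j : Fin 3, cross (EuclideanSpace.single j 1) (A (EuclideanSpace.single j 1))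
      map_add' := fun A B ↦ by simp [← crossL_apply, Finset.sum_add_distrib]
      map_smul' := fun c A ↦ by simp [← crossL_apply, Finset.smul_sum] }

lemma curlOp_apply (A : R3 →L[ℝ] R3) :
    curlOp A = ∑ j : Fin 3, cross (EuclideanSpace.single j 1) (A (EuclideanSpace.single j 1)) := rfl

/-- Factoring through the derivative makes linearity, locality and limits of the curl consequences
of the same facts for `fderiv`. -/
lemma curl_eq (Φ : R3 → R3) (x : R3) : curl Φ x = curlOp (fderiv ℝ Φ x) := by
  rw [curlOp_apply]
  ext i
  fin_cases i <;>
    simp [curl, partialDeriv, cross, crossProduct, Fin.sum_univ_three] <;> ring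

lemma gradient_eq_sum (φ : R3 → ℝ) (x : R3) :
    gradient φ x = ∑ j : Fin 3, fderiv ℝ φ x (EuclideanSpace.single j 1) •
      (EuclideanSpace.single j 1 : R3) := by
  have h : ∀ i, gradient φ x i = fderiv ℝ φ x (EuclideanSpace.single i 1) := fun i ↦ by
    have := InnerProductSpace.toDual_symm_apply (𝕜 := ℝ) (x := (EuclideanSpace.single i 1 : R3))
      (y := fderiv ℝ φ x)
    rw [← this, EuclideanSpace.inner_single_right]
    simp [gradient]
  ext i
  fin_cases i <;> simp [h, Fin.sum_univ_three]

lemma curl_smul {χ : R3 → ℝ} {Φ : R3 → R3} {x : R3} (hχ : DifferentiableAt ℝ χ x)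
    (hΦ : DifferentiableAt ℝ Φ x) :
    curl (fun y ↦ χ y • Φ y) x = χ x • curl Φ x + cross (gradient χ x) (Φ x) := by
  rw [curl_eq, curl_eq, fderiv_fun_smul hχ hΦ, map_add, map_smul, gradient_eq_sum]
  congr 1
  simp [curlOp_apply, ← crossL_apply]

lemma curl_smul_const {φ : R3 → ℝ} {x : R3} (hφ : DifferentiableAt ℝ φ x) (c : R3) :
    curl (fun y ↦ φ y • c) x = cross (gradient φ x) c := by
  rw [curl_smul hφ (differentiableAt_const c), curl_eq]
  simp

/-- The vectorial boundary pairing `∫_V Φ · dμ - ∫_V curl Φ · F`. -/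
noncomputable def boundaryForm (V : Set R3) (F : R3 → R3) (μ : VectorMeasure R3 R3)
    (Φ : R3 → R3) : ℝ :=
  (∫ᵛ x in V, Φ x ∂[innerB; μ]) - ∫ x in V, ⟪curl Φ x, F x⟫

/-! ### C¹ test fields, integrability and linearity of the boundary pairing -/

section TestFields

variable {E : Type*} [NormedAddCommGroup E] [NormedSpace ℝ E]

/-- The product of a test function and a `C¹` function. -/
noncomputable def smulTest {Ω : TopologicalSpace.Opens R3} {χ : R3 → ℝ} (hχ : ContDiff ℝ 1 χ)
    (Φ : 𝓓^{1}(Ω, E)) : 𝓓^{1}(Ω, E) where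
  toFun x := χ x • Φ x
  contDiff' := hχ.smul Φ.contDiff
  hasCompactSupport' := Φ.hasCompactSupport.smul_left
  tsupport_subset' := (tsupport_smul_subset_right χ Φ).trans Φ.tsupport_subset

@[simp] lemma smulTest_apply {Ω : TopologicalSpace.Opens R3} {χ : R3 → ℝ} (hχ : ContDiff ℝ 1 χ)
    (Φ : 𝓓^{1}(Ω, E)) (x : R3) : smulTest hχ Φ x = χ x • Φ x := rfl

/-- The product of a `C¹` function supported in `Ω` and a compactly supported `C¹` field. -/
noncomputable def cutoffTest {Ω : TopologicalSpace.Opens R3} {χ : R3 → ℝ} (hχ : ContDiff ℝ 1 χ)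
    (hs : tsupport χ ⊆ Ω) {g : R3 → E} (hg : ContDiff ℝ 1 g) (hgc : HasCompactSupport g) :
    𝓓^{1}(Ω, E) where
  toFun x := χ x • g x
  contDiff' := hχ.smul hg
  hasCompactSupport' := hgc.smul_left
  tsupport_subset' := (tsupport_smul_subset_left χ g).trans hs

@[simp] lemma cutoffTest_apply {Ω : TopologicalSpace.Opens R3} {χ : R3 → ℝ} (hχ : ContDiff ℝ 1 χ)
    (hs : tsupport χ ⊆ Ω) {g : R3 → E} (hg : ContDiff ℝ 1 g) (hgc : HasCompactSupport g) (x : R3) :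
    cutoffTest hχ hs hg hgc x = χ x • g x := rfl

lemma tsupport_cutoffTest_subset {Ω : TopologicalSpace.Opens R3} {χ : R3 → ℝ}
    (hχ : ContDiff ℝ 1 χ) (hs : tsupport χ ⊆ Ω) {g : R3 → E} (hg : ContDiff ℝ 1 g)
    (hgc : HasCompactSupport g) : tsupport (cutoffTest hχ hs hg hgc) ⊆ tsupport χ :=
  tsupport_smul_subset_left χ g

end TestFields

lemma continuous_curl {Φ : R3 → R3} (hΦ : ContDiff ℝ 1 Φ) : Continuous (curl Φ) := by
  simp only [funext (curl_eq Φ)]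
  exact curlOp.continuous.comp (hΦ.continuous_fderiv one_ne_zero)

lemma curl_eq_zero_of_notMem_tsupport {Φ : R3 → R3} {x : R3} (hx : x ∉ tsupport Φ) :
    curl Φ x = 0 := by
  rw [curl_eq, image_eq_zero_of_notMem_tsupport fun h ↦ hx (tsupport_fderiv_subset ℝ h), map_zero]

lemma hasCompactSupport_curl {Φ : R3 → R3} (hΦ : HasCompactSupport Φ) :
    HasCompactSupport (curl Φ) :=
  HasCompactSupport.intro hΦ fun _ hx ↦ curl_eq_zero_of_notMem_tsupport hx

/-- A measurable field that is essentially bounded by `M` on `Ω`. -/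
structure BoundedOn (Ω : Set R3) (F : R3 → R3) (M : ℝ) : Prop where
  aestronglyMeasurable : AEStronglyMeasurable F (volume.restrict Ω)
  bound : ∀ᵐ x ∂volume.restrict Ω, ‖F x‖ ≤ M

lemma BoundedOn.mono {Ω V : Set R3} {F : R3 → R3} {M : ℝ} (h : BoundedOn Ω F M) (hV : V ⊆ Ω) :
    BoundedOn V F M :=
  ⟨h.1.mono_measure (Measure.restrict_mono hV le_rfl),
    ae_restrict_of_ae_restrict_of_subset hV h.2⟩

lemma BoundedOn.integrable_inner {V : Set R3} {F : R3 → R3} {M : ℝ} (h : BoundedOn V F M)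
    {G : R3 → R3} (hG : Integrable G) : Integrable (fun x ↦ ⟪G x, F x⟫) (volume.restrict V) := by
  refine Integrable.mono' (hG.norm.integrableOn.mul_const M)
    (hG.aestronglyMeasurable.restrict.inner h.1) ?_
  filter_upwards [h.2] with x hx
  exact (norm_inner_le_norm _ _).trans (by gcongr)

lemma integrable_curl {Φ : R3 → R3} (hΦ : ContDiff ℝ 1 Φ) (hc : HasCompactSupport Φ) :
    Integrable (curl Φ) :=
  (continuous_curl hΦ).integrable_of_hasCompactSupport (hasCompactSupport_curl hc)

lemma integrable_vectorMeasure {E F : Type*} [NormedAddCommGroup E] [NormedAddCommGroup F]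
    {Φ : R3 → E} (hΦ : Continuous Φ) (hc : HasCompactSupport Φ)
    (μ : VectorMeasure R3 F) [IsFiniteMeasure μ.variation] : μ.Integrable Φ :=
  hΦ.integrable_of_hasCompactSupport hc

section Linear

variable {Ω : TopologicalSpace.Opens R3} {V : Set R3} {F : R3 → R3} {M : ℝ}
  {μ : VectorMeasure R3 R3} [IsFiniteMeasure μ.variation]

lemma boundaryForm_add (hF : BoundedOn V F M) (Φ Ψ : 𝓓^{1}(Ω, R3)) :
    boundaryForm V F μ (Φ + Ψ : 𝓓^{1}(Ω, R3)) = boundaryForm V F μ Φ + boundaryForm V F μ Ψ := by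
  have hcurl : ∀ x, curl (Φ + Ψ : 𝓓^{1}(Ω, R3)) x = curl Φ x + curl Ψ x := fun x ↦ by
    rw [curl_eq, curl_eq, curl_eq, ← map_add, ← fderiv_add
      (Φ.contDiff.differentiable one_ne_zero x) (Ψ.contDiff.differentiable one_ne_zero x)]
    rfl
  simp only [boundaryForm, hcurl, inner_add_left]
  rw [integral_add (hF.integrable_inner (integrable_curl Φ.contDiff Φ.hasCompactSupport))
    (hF.integrable_inner (integrable_curl Ψ.contDiff Ψ.hasCompactSupport))]
  have : ∀ x, (Φ + Ψ : 𝓓^{1}(Ω, R3)) x = Φ x + Ψ x := fun _ ↦ rfl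
  simp only [this]
  rw [VectorMeasure.integral_fun_add
    (integrable_vectorMeasure Φ.continuous Φ.hasCompactSupport μ).restrict
    (integrable_vectorMeasure Ψ.continuous Ψ.hasCompactSupport μ).restrict]
  ring

omit [IsFiniteMeasure μ.variation] in
lemma boundaryForm_smul (c : ℝ) (Φ : 𝓓^{1}(Ω, R3)) :
    boundaryForm V F μ (c • Φ : 𝓓^{1}(Ω, R3)) = c * boundaryForm V F μ Φ := by
  have hcurl : ∀ x, curl (c • Φ : 𝓓^{1}(Ω, R3)) x = c • curl Φ x := fun x ↦ by
    rw [curl_eq, curl_eq, ← map_smul, ← fderiv_const_smul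
      (Φ.contDiff.differentiable one_ne_zero x)]
    rfl
  have : ∀ x, (c • Φ : 𝓓^{1}(Ω, R3)) x = c • Φ x := fun _ ↦ rfl
  simp only [boundaryForm, hcurl, inner_smul_left, this, VectorMeasure.integral_fun_smul,
    integral_const_mul]
  simp [mul_sub]

end Linear

/-- Bounded convergence with respect to the finite variation measure of `μ`. -/
lemma tendsto_setIntegral_vectorMeasure {V : Set R3} (hV : MeasurableSet V)
    {μ : VectorMeasure R3 R3} [IsFiniteMeasure μ.variation] {Φ : ℕ → R3 → R3} {Ψ : R3 → R3}
    (hΦ : ∀ k, Continuous (Φ k)) {C : ℝ} (hC : ∀ k x, ‖Φ k x‖ ≤ C)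
    (hlim : ∀ x ∈ V, Tendsto (fun k ↦ Φ k x) atTop (𝓝 (Ψ x))) :
    Tendsto (fun k ↦ ∫ᵛ x in V, Φ k x ∂[innerB; μ]) atTop (𝓝 (∫ᵛ x in V, Ψ x ∂[innerB; μ])) := by
  refine VectorMeasure.tendsto_integral_filter_of_norm_le_const
    (.of_forall fun k ↦ (hΦ k).aestronglyMeasurable)
    ⟨C, .of_forall fun k ↦ .of_forall (hC k)⟩ ?_
  rw [VectorMeasure.variation_restrict hV]
  exact (ae_restrict_iff' hV).2 (.of_forall hlim)

/-! ### Mollification of Lipschitz functions -/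

section Mollification

open scoped Convolution ContDiff
open ContinuousLinearMap (lsmul lsmul_apply)

variable {E F : Type*} [NormedAddCommGroup E] [InnerProductSpace ℝ E] [FiniteDimensional ℝ E]
  [MeasurableSpace E] [BorelSpace E] [NormedAddCommGroup F] [NormedSpace ℝ F]
  [FiniteDimensional ℝ F] {K : ℝ≥0} {f : E → F}

lemma integrable_normed_smul (φ : ContDiffBump (0 : E)) {G : Type*} [NormedAddCommGroup G]
    [NormedSpace ℝ G] {h : E → G} (hh : LocallyIntegrable h volume) (x : E) :
    Integrable (fun t ↦ φ.normed volume t • h (x - t)) := by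
  have := (φ.hasCompactSupport_normed (μ := volume)).convolutionExists_left (lsmul ℝ ℝ)
    φ.continuous_normed hh x
  exact this

/-- The convolution averages translates of `f` with total weight one, so the Lipschitz constant does
not grow. -/
lemma lipschitzWith_normed_convolution (hf : LipschitzWith K f) (φ : ContDiffBump (0 : E)) :
    LipschitzWith K (φ.normed volume ⋆[lsmul ℝ ℝ, volume] f) := by
  have hloc := hf.continuous.locallyIntegrable (μ := (volume : Measure E))
  refine LipschitzWith.of_dist_le_mul fun x y ↦ ?_
  simp only [convolution_def, lsmul_apply, dist_eq_norm]
  rw [← integral_sub (integrable_normed_smul φ hloc x) (integrable_normed_smul φ hloc y)]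
  calc ‖∫ t, (φ.normed volume t • f (x - t) - φ.normed volume t • f (y - t))‖
      ≤ ∫ t, φ.normed volume t * (K * ‖x - y‖) := by
        refine norm_integral_le_of_norm_le (φ.integrable_normed.mul_const _) (.of_forall fun t ↦ ?_)
        rw [← smul_sub, norm_smul, Real.norm_of_nonneg (φ.nonneg_normed t)]
        gcongr
        · exact φ.nonneg_normed t
        · simpa [dist_eq_norm] using hf.dist_le_mul (x - t) (y - t)
    _ = K * ‖x - y‖ := by rw [integral_mul_const, φ.integral_normed, one_mul]

lemma locallyIntegrable_fderiv (hf : LipschitzWith K f) :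
    LocallyIntegrable (fderiv ℝ f) (volume : Measure E) := by
  refine fun x ↦ ⟨Metric.ball x 1, Metric.ball_mem_nhds x one_pos, ?_⟩
  exact Measure.integrableOn_of_bounded (M := K) measure_ball_lt_top.ne
    (measurable_fderiv ℝ f).aestronglyMeasurable
    (.of_forall fun y ↦ norm_fderiv_le_of_lipschitz ℝ hf)

/-- The derivative is put on `f` rather than on the kernel: for fixed `x`, Rademacher's theorem
makes `f` differentiable at `x - t` for almost every `t`, and the Lipschitz bound dominates the
difference quotients. -/
lemma fderiv_normed_convolution (hf : LipschitzWith K f) (φ : ContDiffBump (0 : E)) (x : E) :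
    fderiv ℝ (φ.normed volume ⋆[lsmul ℝ ℝ, volume] f) x =
      (φ.normed volume ⋆[lsmul ℝ ℝ, volume] fderiv ℝ f) x := by
  have hloc := hf.continuous.locallyIntegrable (μ := (volume : Measure E))
  refine HasFDerivAt.fderiv ?_
  simp only [convolution_def, lsmul_apply]
  refine (hasFDerivAt_integral_of_dominated_loc_of_lip
    (F := fun y t ↦ φ.normed volume t • f (y - t)) (bound := fun t ↦ φ.normed volume t * K)
    (s := univ) univ_mem ?_ ?_ ?_ ?_ ?_ ?_).2
  · exact .of_forall fun y ↦ (integrable_normed_smul φ hloc y).aestronglyMeasurable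
  · exact integrable_normed_smul φ hloc x
  · exact (integrable_normed_smul φ (locallyIntegrable_fderiv hf) x).aestronglyMeasurable
  · refine .of_forall fun t ↦ (LipschitzWith.of_dist_le_mul fun y z ↦ ?_).lipschitzOnWith
    rw [dist_eq_norm, ← smul_sub, norm_smul, Real.coe_nnabs, Real.norm_of_nonneg
      (φ.nonneg_normed t), abs_of_nonneg (by exact mul_nonneg (φ.nonneg_normed t) K.2), mul_assoc]
    gcongr
    · exact φ.nonneg_normed t
    · simpa [dist_eq_norm] using hf.dist_le_mul (y - t) (z - t)
  · exact φ.integrable_normed.mul_const _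
  · have hmp : MeasurePreserving (fun t ↦ x - t) (volume : Measure E) volume :=
      Measure.measurePreserving_sub_left volume x
    filter_upwards [hmp.quasiMeasurePreserving.ae (hf.ae_differentiableAt (μ := volume))] with t ht
    have := ht.hasFDerivAt.comp x ((hasFDerivAt_id x).sub_const t)
    exact this.const_smul (φ.normed volume t)

/-- Mollification of a Lipschitz function. -/
lemma exists_contDiff_lipschitz_approx (hf : LipschitzWith K f) :
    ∃ u : ℕ → E → F, (∀ k, ContDiff ℝ ∞ (u k)) ∧ (∀ k, LipschitzWith K (u k)) ∧
      (∀ k x, ‖u k x - f x‖ ≤ K * (1 / ((k : ℝ) + 1))) ∧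
      (∀ᵐ x, Tendsto (fun k ↦ fderiv ℝ (u k) x) atTop (𝓝 (fderiv ℝ f x))) ∧
      ∀ k, Function.support (u k) ⊆ Metric.thickening (1 / ((k : ℝ) + 1)) (Function.support f) := by
  let φ : ℕ → ContDiffBump (0 : E) := fun k ↦
    -- The fixed ratio 2 of the radii is the `K := 2` that the almost everywhere convergence below
    -- relies on.
    { rIn := 1 / ((k : ℝ) + 1) / 2
      rOut := 1 / ((k : ℝ) + 1)
      rIn_pos := by positivity
      rIn_lt_rOut := half_lt_self (by positivity) }
  refine ⟨fun k ↦ (φ k).normed volume ⋆[lsmul ℝ ℝ, volume] f, fun k ↦ ?_, fun k ↦ ?_,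
    fun k x ↦ ?_, ?_, fun k ↦ ?_⟩
  · exact (φ k).hasCompactSupport_normed.contDiff_convolution_left _ (φ k).contDiff_normed
      hf.continuous.locallyIntegrable
  · exact lipschitzWith_normed_convolution hf (φ k)
  · rw [← dist_eq_norm]
    refine (φ k).dist_normed_convolution_le hf.continuous.aestronglyMeasurable fun y hy ↦ ?_
    refine (hf.dist_le_mul y x).trans ?_
    gcongr
    exact (Metric.mem_ball.1 hy).le
  · simp only [fderiv_normed_convolution hf]
    refine ContDiffBump.ae_convolution_tendsto_right_of_locallyIntegrable (K := 2)
      tendsto_one_div_add_atTop_nhds_zero_nat (.of_forall fun k ↦ ?_)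
      (locallyIntegrable_fderiv hf)
    simp [φ]
    field_simp
    exact le_rfl
  · refine (support_convolution_subset _).trans ?_
    rintro _ ⟨a, ha, b, hb, rfl⟩
    rw [(φ k).support_normed_eq] at ha
    refine Metric.mem_thickening_iff.2 ⟨b, hb, ?_⟩
    simpa [dist_eq_norm, φ] using ha

end Mollification

/-! ### The curl identity for C¹ test fields -/

section Extension

open scoped ContDiff

variable {Ω : TopologicalSpace.Opens R3} {F : R3 → R3} {M : ℝ} {μ : VectorMeasure R3 R3}

/-- The identity defining the distributional curl extends to `C¹` test fields. -/
lemma HasCurlMeasure.boundaryForm_eq_zero (hμ : HasCurlMeasure Ω F μ) (hF : BoundedOn Ω F M)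
    (Φ : 𝓓^{1}(Ω, R3)) : boundaryForm Ω F μ Φ = 0 := by
  have := hμ.finite_variation
  obtain ⟨K, hK⟩ := ContDiff.lipschitzWith_of_hasCompactSupport Φ.hasCompactSupport Φ.contDiff
    one_ne_zero
  obtain ⟨u, hu, huK, hulim, hfd, hsupp⟩ := exists_contDiff_lipschitz_approx hK
  obtain ⟨δ, hδ, hδΩ⟩ := Φ.hasCompactSupport.isCompact.exists_cthickening_subset_open Ω.isOpen
    Φ.tsupport_subset
  have hr : Tendsto (fun k : ℕ ↦ 1 / ((k : ℝ) + 1)) atTop (𝓝 0) :=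
    tendsto_one_div_add_atTop_nhds_zero_nat
  obtain ⟨N, hN⟩ := eventually_atTop.1 (hr.eventually_lt_const hδ)
  -- From index `N` on the mollification radius is below `δ`, so all supports stay in one compact
  -- subset of `Ω`.
  have hts : ∀ k, tsupport (u (k + N)) ⊆ Metric.cthickening δ (tsupport Φ) := fun k ↦
    closure_minimal ((hsupp _).trans ((Metric.thickening_mono (hN _ (by lia)).le _).trans
      ((Metric.thickening_subset_of_subset _ (subset_tsupport _)).trans
        (Metric.thickening_subset_cthickening _ _)))) Metric.isClosed_cthickening
  have hcpt : IsCompact (Metric.cthickening δ (tsupport Φ)) :=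
    Φ.hasCompactSupport.isCompact.cthickening
  let ψ : ℕ → 𝓓(Ω, R3) := fun k ↦
    ⟨u (k + N), hu _, hcpt.of_isClosed_subset (isClosed_tsupport _) (hts k), (hts k).trans hδΩ⟩
  have hψ : ∀ k x, ψ k x = u (k + N) x := fun _ _ ↦ rfl
  obtain ⟨C, hC⟩ := Φ.continuous.bounded_above_of_compact_support Φ.hasCompactSupport
  have h1 : Tendsto (fun k ↦ ∫ᵛ x in (Ω : Set R3), ψ k x ∂[innerB; μ]) atTop
      (𝓝 (∫ᵛ x in (Ω : Set R3), Φ x ∂[innerB; μ])) := by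
    refine tendsto_setIntegral_vectorMeasure Ω.isOpen.measurableSet (fun k ↦ (ψ k).continuous)
      (C := C + K) (fun k x ↦ ?_) fun x _ ↦ ?_
    · rw [hψ, ← sub_add_cancel (u (k + N) x) (Φ x), add_comm]
      refine (norm_add_le _ _).trans (add_le_add (hC x) ((hulim _ _).trans ?_))
      refine mul_le_of_le_one_right K.2 ?_
      rw [div_le_one (by positivity)]
      linarith [Nat.cast_nonneg (α := ℝ) (k + N)]
    · rw [tendsto_iff_norm_sub_tendsto_zero]
      refine squeeze_zero (fun _ ↦ norm_nonneg _) (fun k ↦ hulim (k + N) x) ?_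
      simpa using ((tendsto_add_atTop_iff_nat N).2 hr).const_mul (K : ℝ)
  have h2 : Tendsto (fun k ↦ ∫ x in (Ω : Set R3), ⟪F x, curl (ψ k) x⟫) atTop
      (𝓝 (∫ x in (Ω : Set R3), ⟪F x, curl Φ x⟫)) := by
    refine tendsto_integral_filter_of_dominated_convergence
      ((Metric.cthickening δ (tsupport Φ)).indicator fun _ ↦ M * (‖curlOp‖ * K))
      (.of_forall fun k ↦ ?_) (.of_forall fun k ↦ ?_) ?_ ?_
    · exact hF.1.inner (continuous_curl ((ψ k).contDiff.of_le (by simp))).aestronglyMeasurable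
    · filter_upwards [hF.2] with x hx
      by_cases h : x ∈ Metric.cthickening δ (tsupport Φ)
      · rw [indicator_of_mem h]
        refine (norm_inner_le_norm _ _).trans ?_
        have : ‖curl (ψ k) x‖ ≤ ‖curlOp‖ * K := by
          rw [curl_eq]
          exact (curlOp.le_opNorm _).trans (by gcongr; exact norm_fderiv_le_of_lipschitz ℝ (huK _))
        exact mul_le_mul hx this (norm_nonneg _) ((norm_nonneg _).trans hx)
      · have : curl (ψ k) x = 0 := curl_eq_zero_of_notMem_tsupport fun h' ↦ h (hts k h')
        simp [h, this]
    · exact ((integrable_indicator_iff hcpt.measurableSet).2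
        (integrableOn_const hcpt.measure_lt_top.ne)).restrict
    · filter_upwards [ae_restrict_of_ae hfd] with x hx
      simp only [curl_eq]
      exact tendsto_const_nhds.inner ((curlOp.continuous.tendsto _).comp
        (hx.comp (tendsto_add_atTop_nat N)))
  have h3 := tendsto_nhds_unique h1 ((h2.congr fun k ↦ hμ.integral_curl (ψ k)))
  simp only [boundaryForm, h3, real_inner_comm, sub_self]

end Extension

/-! ### Cutoffs and rescaling in thin layers above a graph -/

/-- The Euclidean plane. -/
abbrev E2 : Type := EuclideanSpace ℝ (Fin 2)

section Transition

lemma differentiable_smoothTransition : Differentiable ℝ Real.smoothTransition :=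
  (Real.smoothTransition.contDiff (n := 1)).differentiable (by simp)

lemma continuous_deriv_smoothTransition : Continuous (deriv Real.smoothTransition) :=
  (Real.smoothTransition.contDiff (n := 1)).continuous_deriv (by simp)

lemma deriv_smoothTransition_nonneg (t : ℝ) : 0 ≤ deriv Real.smoothTransition t :=
  Real.smoothTransition.monotone.deriv_nonneg

/-- Every such point is a global minimum, which also covers the endpoint `t = 0`. -/
lemma deriv_smoothTransition_of_nonpos {t : ℝ} (ht : t ≤ 0) :
    deriv Real.smoothTransition t = 0 := by
  refine IsLocalMin.deriv_eq_zero (.of_forall fun s ↦ ?_)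
  rw [Real.smoothTransition.zero_of_nonpos ht]
  exact Real.smoothTransition.nonneg s

lemma deriv_smoothTransition_of_one_le {t : ℝ} (ht : 1 ≤ t) :
    deriv Real.smoothTransition t = 0 := by
  refine IsLocalMax.deriv_eq_zero (.of_forall fun s ↦ ?_)
  rw [Real.smoothTransition.one_of_one_le ht]
  exact Real.smoothTransition.le_one s

lemma deriv_smoothTransition_of_notMem {t : ℝ} (ht : t ∉ Icc (0 : ℝ) 1) :
    deriv Real.smoothTransition t = 0 := by
  rcases lt_or_ge t 0 with h | h
  · exact deriv_smoothTransition_of_nonpos h.le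
  · exact deriv_smoothTransition_of_one_le (not_lt.1 fun h' ↦ ht ⟨h, h'.le⟩)

end Transition

/-- Vertical rescaling around the graph of `G`. -/
lemma integral_layer {A : E2 × ℝ → ℝ} (hA : Continuous A) (hAc : HasCompactSupport A)
    {G : E2 → ℝ} (hG : Continuous G) {c : ℝ} (hc : 0 < c) :
    ∫ q : E2 × ℝ, c * deriv Real.smoothTransition (c * (q.2 - G q.1)) * A q =
      ∫ q : E2 × ℝ, deriv Real.smoothTransition q.2 * A (q.1, G q.1 + q.2 / c) := by
  have hS := continuous_deriv_smoothTransition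
  have h1 : Integrable fun q : E2 × ℝ ↦
      c * deriv Real.smoothTransition (c * (q.2 - G q.1)) * A q :=
    Continuous.integrable_of_hasCompactSupport (by fun_prop) hAc.mul_left
  have h2 : Integrable fun q : E2 × ℝ ↦
      deriv Real.smoothTransition q.2 * A (q.1, G q.1 + q.2 / c) := by
    refine Continuous.integrable_of_hasCompactSupport (by fun_prop) ?_
    refine HasCompactSupport.intro (K := (Prod.fst '' tsupport A) ×ˢ Icc (0 : ℝ) 1)
      ((hAc.isCompact.image continuous_fst).prod isCompact_Icc) fun q hq ↦ ?_
    by_cases hq2 : q.2 ∈ Icc (0 : ℝ) 1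
    · have : (q.1, G q.1 + q.2 / c) ∉ tsupport A := fun h ↦ hq ⟨⟨_, h, rfl⟩, hq2⟩
      simp [image_eq_zero_of_notMem_tsupport this]
    · simp [deriv_smoothTransition_of_notMem hq2]
  rw [Measure.volume_eq_prod] at h1 h2 ⊢
  rw [integral_prod _ h1, integral_prod _ h2]
  refine integral_congr_ae (.of_forall fun p ↦ ?_)
  -- On each vertical line, `e1` translates by the height of the graph and `e2` rescales by `c`.
  have e1 := integral_add_right_eq_self (μ := (volume : Measure ℝ))
    (fun s ↦ c * deriv Real.smoothTransition (c * (s - G p)) * A (p, s)) (G p)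
  have e2 : ∫ s, deriv Real.smoothTransition s * A (p, G p + s / c) =
      c * ∫ s, deriv Real.smoothTransition (c * s) * A (p, G p + c * s / c) := by
    rw [Measure.integral_comp_mul_left
      (fun s ↦ deriv Real.smoothTransition s * A (p, G p + s / c)) c, abs_of_pos (inv_pos.2 hc),
      smul_eq_mul, mul_inv_cancel_left₀ hc.ne']
  simp only
  rw [← e1, e2, ← integral_const_mul]
  refine integral_congr_ae (.of_forall fun s ↦ ?_)
  simp only [add_sub_cancel_left, mul_div_cancel_left₀ _ hc.ne', add_comm s (G p), mul_assoc]

/-- The gradient of `x ↦ (e x).2 - A (e x).1`, a normal vector to the graph with slope `A`. -/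
noncomputable def slopeNormal (e : R3 ≃L[ℝ] E2 × ℝ) (A : E2 →L[ℝ] ℝ) : R3 :=
  (InnerProductSpace.toDual ℝ R3).symm
    ((ContinuousLinearMap.snd ℝ E2 ℝ - A ∘L ContinuousLinearMap.fst ℝ E2 ℝ) ∘L
      (e : R3 →L[ℝ] E2 × ℝ))

lemma inner_slopeNormal (e : R3 ≃L[ℝ] E2 × ℝ) (A : E2 →L[ℝ] ℝ) (v : R3) :
    ⟪slopeNormal e A, v⟫ = (e v).2 - A (e v).1 := by
  rw [slopeNormal, InnerProductSpace.toDual_symm_apply]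
  simp

lemma continuous_slopeNormal (e : R3 ≃L[ℝ] E2 × ℝ) : Continuous (slopeNormal e) := by
  unfold slopeNormal
  refine (LinearIsometryEquiv.continuous _).comp ?_
  fun_prop

lemma exists_norm_slopeNormal_le (e : R3 ≃L[ℝ] E2 × ℝ) (K : ℝ) :
    ∃ C, 0 ≤ C ∧ ∀ A : E2 →L[ℝ] ℝ, ‖A‖ ≤ K → ‖slopeNormal e A‖ ≤ C := by
  obtain ⟨C, hC⟩ := (isCompact_closedBall (0 : E2 →L[ℝ] ℝ) K).exists_bound_of_continuousOn
    (continuous_slopeNormal e).continuousOn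
  exact ⟨max C 0, le_max_right _ _, fun A hA ↦ (hC A (by simpa using hA)).trans (le_max_left _ _)⟩

section Cutoff

variable (e : R3 ≃L[ℝ] E2 × ℝ) {G : E2 → ℝ} (c : ℝ)

/-- A smooth cutoff that vanishes below the graph of `G` and equals one at height `1 / c` above. -/
noncomputable def graphCutoff (G : E2 → ℝ) (x : R3) : ℝ :=
  Real.smoothTransition (c * ((e x).2 - G (e x).1))

lemma contDiff_graphCutoff (hG : ContDiff ℝ 1 G) : ContDiff ℝ 1 (graphCutoff e c G) := by
  unfold graphCutoff
  have := Real.smoothTransition.contDiff (n := 1)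
  have he : ContDiff ℝ 1 e := e.contDiff
  exact this.comp (contDiff_const.mul (he.snd.sub (hG.comp he.fst)))

/-- The gradient is a multiple of the normal to the graph, which is why only the tangential part of
a test field survives in the layer. -/
lemma gradient_graphCutoff (hG : Differentiable ℝ G) (x : R3) :
    gradient (graphCutoff e c G) x =
      (c * deriv Real.smoothTransition (c * ((e x).2 - G (e x).1))) •
        slopeNormal e (fderiv ℝ G (e x).1) := by
  have he : HasFDerivAt e (e : R3 →L[ℝ] E2 × ℝ) x := e.hasFDerivAt
  have h1 : HasFDerivAt (fun y ↦ (e y).2 - G (e y).1)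
      ((ContinuousLinearMap.snd ℝ E2 ℝ - fderiv ℝ G (e x).1 ∘L ContinuousLinearMap.fst ℝ E2 ℝ) ∘L
      (e : R3 →L[ℝ] E2 × ℝ)) x :=
    (he.snd.sub ((hG (e x).1).hasFDerivAt.comp x he.fst))
  have h2 := (differentiable_smoothTransition _).hasDerivAt.comp_hasFDerivAt x (h1.const_mul c)
  unfold gradient
  have h3 : fderiv ℝ (graphCutoff e c G) x = _ := h2.fderiv
  rw [h3, slopeNormal, ← map_smul, smul_smul, mul_comm c (deriv _ _)]

end Cutoff

/-! ### The boundary pairing above a Lipschitz graph -/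

section GraphEstimate

variable {Ω : TopologicalSpace.Opens R3} {F : R3 → R3} {M : ℝ} {μ : VectorMeasure R3 R3}
  {V : Set R3}

lemma curl_cutoff (e : R3 ≃L[ℝ] E2 × ℝ) {G : E2 → ℝ} (c : ℝ) (hG : ContDiff ℝ 1 G)
    (Φ : 𝓓^{1}(Ω, R3)) (x : R3) :
    curl (smulTest (contDiff_graphCutoff e c hG) Φ) x =
      graphCutoff e c G x • curl Φ x +
        (c * deriv Real.smoothTransition (c * ((e x).2 - G (e x).1))) •
          cross (slopeNormal e (fderiv ℝ G (e x).1)) (Φ x) := by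
  have := curl_smul ((contDiff_graphCutoff e c hG).differentiable one_ne_zero x)
    (Φ.contDiff.differentiable one_ne_zero x)
  rw [gradient_graphCutoff e c (hG.differentiable one_ne_zero), cross_smul_left] at this
  exact this

/-- A field and its curl that vanish on `Ω \ V` have the same boundary pairing on `V` and `Ω`. -/
lemma boundaryForm_eq_of_eqOn_zero (hV : MeasurableSet V) (hVΩ : V ⊆ Ω) {Ψ : R3 → R3}
    (h0 : ∀ x ∈ (Ω : Set R3) \ V, Ψ x = 0) (h1 : ∀ x ∈ (Ω : Set R3) \ V, curl Ψ x = 0) :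
    boundaryForm V F μ Ψ = boundaryForm Ω F μ Ψ := by
  rw [boundaryForm, boundaryForm,
    VectorMeasure.setIntegral_eq_of_subset_of_forall_sdiff_eq_zero hV Ω.isOpen.measurableSet hVΩ h0,
    setIntegral_eq_of_subset_of_forall_sdiff_eq_zero Ω.isOpen.measurableSet hVΩ
      fun x hx ↦ by rw [h1 x hx, inner_zero_left]]

/-- The average of the tangential part of `Φ` over a thin layer above the graph of `G`. -/
noncomputable def layerIntegral (e : R3 ≃L[ℝ] E2 × ℝ) (Φ : R3 → R3) (c : ℝ) (G : E2 → ℝ) : ℝ :=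
  ∫ q : E2 × ℝ, deriv Real.smoothTransition q.2 *
    ‖cross (slopeNormal e (fderiv ℝ G q.1)) (Φ (e.symm (q.1, G q.1 + q.2 / c)))‖

lemma continuous_cross_slopeNormal (e : R3 ≃L[ℝ] E2 × ℝ) {G : E2 → ℝ} (hG : ContDiff ℝ 1 G)
    {Φ : R3 → R3} (hΦ : Continuous Φ) :
    Continuous fun x ↦ cross (slopeNormal e (fderiv ℝ G (e x).1)) (Φ x) :=
  ((continuous_slopeNormal e).comp ((hG.continuous_fderiv one_ne_zero).comp
    (continuous_fst.comp e.continuous))).cross hΦ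

/-- The factor `c` from the gradient is absorbed by the vertical rescaling, so the mass of the layer
term stays bounded as the layer shrinks. -/
lemma integral_norm_layer {e : R3 ≃L[ℝ] E2 × ℝ} (he : MeasurePreserving e volume volume)
    {G : E2 → ℝ} (hG : ContDiff ℝ 1 G) {c : ℝ} (hc : 0 < c) {Φ : R3 → R3} (hΦ : Continuous Φ)
    (hΦc : HasCompactSupport Φ) :
    ∫ x, ‖(c * deriv Real.smoothTransition (c * ((e x).2 - G (e x).1))) •
      cross (slopeNormal e (fderiv ℝ G (e x).1)) (Φ x)‖ = layerIntegral e Φ c G := by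
  let A : E2 × ℝ → ℝ := fun q ↦ ‖cross (slopeNormal e (fderiv ℝ G q.1)) (Φ (e.symm q))‖
  have hA : Continuous A := by
    have h := (continuous_cross_slopeNormal e hG hΦ).comp e.symm.continuous
    simpa [Function.comp_def] using h.norm
  have hAc : HasCompactSupport A := by
    refine HasCompactSupport.intro (hΦc.isCompact.image e.continuous) fun q hq ↦ ?_
    have : e.symm q ∉ tsupport Φ := fun h ↦ hq ⟨_, h, by simp⟩
    simp [A, image_eq_zero_of_notMem_tsupport this, ← crossL_apply]
  have h1 : layerIntegral e Φ c G =
      ∫ q : E2 × ℝ, c * deriv Real.smoothTransition (c * (q.2 - G q.1)) * A q :=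
    (integral_layer hA hAc hG.continuous hc).symm
  have h2 := he.integral_comp e.toHomeomorph.measurableEmbedding
    (fun q : E2 × ℝ ↦ c * deriv Real.smoothTransition (c * (q.2 - G q.1)) * A q)
  rw [h1, ← h2]
  refine integral_congr_ae (.of_forall fun x ↦ ?_)
  simp only [A, norm_smul, Real.norm_eq_abs, e.symm_apply_apply]
  rw [abs_of_nonneg (mul_nonneg hc.le (deriv_smoothTransition_nonneg _))]

/-- The cutoff field and its curl vanish on `Ω \ V`, so its pairing over `V` is its pairing over
`Ω`, which is zero. The Leibniz rule then leaves only the gradient term, estimated by `‖F‖ ≤ M`. -/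
lemma abs_cutoff_error_le (hμ : HasCurlMeasure Ω F μ) (hF : BoundedOn Ω F M) (hM : 0 ≤ M)
    (hV : MeasurableSet V) (hVΩ : V ⊆ Ω) {e : R3 ≃L[ℝ] E2 × ℝ}
    (he : MeasurePreserving e volume volume) {G : E2 → ℝ} (hG : ContDiff ℝ 1 G) {c : ℝ} (hc : 0 < c)
    (Φ : 𝓓^{1}(Ω, R3)) (hΦ : ∀ x ∈ tsupport Φ, x ∉ V → (e x).2 ≤ G (e x).1) :
    |(∫ᵛ x in V, graphCutoff e c G x • Φ x ∂[innerB; μ])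
        - ∫ x in V, graphCutoff e c G x * ⟪curl Φ x, F x⟫| ≤ M * layerIntegral e Φ c G := by
  have hS := continuous_deriv_smoothTransition
  set Ψ := smulTest (contDiff_graphCutoff e c hG) Φ with hΨ
  have hle : ∀ x, x ∉ V → (e x).2 ≤ G (e x).1 ∨ x ∉ tsupport Φ := fun x hx ↦ by
    by_cases h : x ∈ tsupport Φ
    · exact .inl (hΦ x h hx)
    · exact .inr h
  have hz : boundaryForm V F μ Ψ = 0 := by
    rw [boundaryForm_eq_of_eqOn_zero hV hVΩ (fun x hx ↦ ?_) (fun x hx ↦ ?_),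
      hμ.boundaryForm_eq_zero hF]
    · rcases hle x hx.2 with h | h
      · rw [hΨ, smulTest_apply, graphCutoff, Real.smoothTransition.zero_of_nonpos
          (mul_nonpos_of_nonneg_of_nonpos hc.le (sub_nonpos.2 h)), zero_smul]
      · rw [hΨ, smulTest_apply, image_eq_zero_of_notMem_tsupport h, smul_zero]
    · rw [hΨ, curl_cutoff e c hG Φ]
      rcases hle x hx.2 with h | h
      · have h' := mul_nonpos_of_nonneg_of_nonpos hc.le (sub_nonpos.2 h)
        rw [graphCutoff, Real.smoothTransition.zero_of_nonpos h',
          deriv_smoothTransition_of_nonpos h']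
        simp
      · rw [image_eq_zero_of_notMem_tsupport h, curl_eq_zero_of_notMem_tsupport h]
        simp [← crossL_apply]
  have hcut : Continuous (graphCutoff e c G) := (contDiff_graphCutoff e c hG).continuous
  let r : R3 → R3 := fun x ↦ (c * deriv Real.smoothTransition (c * ((e x).2 - G (e x).1))) •
    cross (slopeNormal e (fderiv ℝ G (e x).1)) (Φ x)
  have hcross : Continuous fun x ↦ cross (slopeNormal e (fderiv ℝ G (e x).1)) (Φ x) :=
    continuous_cross_slopeNormal e hG Φ.continuous
  have hGc := hG.continuous
  have hrc : Continuous r := by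
    have h1 : Continuous fun x ↦ c * deriv Real.smoothTransition (c * ((e x).2 - G (e x).1)) := by
      have := e.continuous
      fun_prop
    exact h1.smul hcross
  have hr : Integrable r := hrc.integrable_of_hasCompactSupport
    (HasCompactSupport.intro Φ.hasCompactSupport fun x hx ↦ by
      simp [r, image_eq_zero_of_notMem_tsupport hx, ← crossL_apply])
  have hFV := hF.mono hVΩ
  have hI : Integrable fun x ↦ graphCutoff e c G x • curl Φ x :=
    (hcut.smul (continuous_curl Φ.contDiff)).integrable_of_hasCompactSupport
      (hasCompactSupport_curl Φ.hasCompactSupport).smul_left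
  have hsplit : (∫ᵛ x in V, graphCutoff e c G x • Φ x ∂[innerB; μ])
      - ∫ x in V, graphCutoff e c G x * ⟪curl Φ x, F x⟫ = ∫ x in V, ⟪r x, F x⟫ := by
    rw [sub_eq_iff_eq_add, ← integral_add (hFV.integrable_inner hr)
      (by simpa [inner_smul_left] using hFV.integrable_inner hI)]
    rw [boundaryForm, sub_eq_zero] at hz
    refine hz.trans (integral_congr_ae (.of_forall fun x ↦ ?_))
    simp only [hΨ, curl_cutoff e c hG Φ, inner_add_left, inner_smul_left, r]
    simp [add_comm]
  rw [hsplit]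
  have hnorm : ∫ x, ‖r x‖ = layerIntegral e Φ c G :=
    integral_norm_layer he hG hc Φ.continuous Φ.hasCompactSupport
  calc |∫ x in V, ⟪r x, F x⟫| ≤ ∫ x in V, M * ‖r x‖ := by
        rw [← Real.norm_eq_abs]
        refine norm_integral_le_of_norm_le (hr.norm.const_mul M).integrableOn ?_
        filter_upwards [hFV.2] with x hx
        exact (norm_inner_le_norm _ _).trans (by rw [mul_comm]; gcongr)
    _ ≤ ∫ x, M * ‖r x‖ := setIntegral_le_integral (hr.norm.const_mul M)
        (.of_forall fun x ↦ by positivity)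
    _ = M * layerIntegral e Φ c G := by rw [integral_const_mul, hnorm]

/-- The mass of the derivative of the smooth transition function. -/
noncomputable def transitionMass : ℝ := ∫ s, deriv Real.smoothTransition s

lemma transitionMass_nonneg : 0 ≤ transitionMass :=
  integral_nonneg deriv_smoothTransition_nonneg

/-- In rescaled variables the thickness enters only through the evaluation point, which tends to the
graph. The common Lipschitz constant bounds the normals, and dominated convergence applies. -/
lemma tendsto_layerIntegral {e : R3 ≃L[ℝ] E2 × ℝ} {g : E2 → ℝ} {K : ℝ≥0} {G : ℕ → E2 → ℝ}
    (hG : ∀ k, ContDiff ℝ 1 (G k)) (hK : ∀ k, LipschitzWith K (G k))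
    (hlim : ∀ p, Tendsto (fun k ↦ G k p) atTop (𝓝 (g p)))
    (hfd : ∀ᵐ p, Tendsto (fun k ↦ fderiv ℝ (G k) p) atTop (𝓝 (fderiv ℝ g p)))
    (Φ : 𝓓^{1}(Ω, R3)) :
    Tendsto (fun k : ℕ ↦ layerIntegral e Φ ((k : ℝ) + 1) (G k)) atTop
      (𝓝 (transitionMass * ∫ p, ‖cross (slopeNormal e (fderiv ℝ g p)) (Φ (e.symm (p, g p)))‖)) := by
  have hS := continuous_deriv_smoothTransition
  obtain ⟨C, hC⟩ := Φ.continuous.bounded_above_of_compact_support Φ.hasCompactSupport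
  have hC0 : 0 ≤ C := (norm_nonneg _).trans (hC 0)
  obtain ⟨N, hN0, hN⟩ := exists_norm_slopeNormal_le e K
  obtain ⟨D, hD⟩ := isCompact_Icc.exists_bound_of_continuousOn (s := Icc (0 : ℝ) 1) hS.continuousOn
  have hcpt : IsCompact ((Prod.fst '' (e '' tsupport Φ)) ×ˢ Icc (0 : ℝ) 1) :=
    ((Φ.hasCompactSupport.isCompact.image e.continuous).image continuous_fst).prod isCompact_Icc
  -- Off this compact set, which does not depend on `k`, every integrand vanishes.
  set B := (Prod.fst '' (e '' tsupport Φ)) ×ˢ Icc (0 : ℝ) 1 with hB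
  rw [transitionMass, mul_comm, ← integral_prod_mul, ← Measure.volume_eq_prod]
  simp only [layerIntegral]
  refine tendsto_integral_of_dominated_convergence
    (B.indicator fun _ ↦ D * (‖crossL‖ * N * C)) (fun k ↦ ?_) ?_ (fun k ↦ ?_) ?_
  · have h1 := (hG k).continuous
    have h2 := (hG k).continuous_fderiv one_ne_zero
    have h3 : Continuous fun q : E2 × ℝ ↦ (q.1, G k q.1 + q.2 / ((k : ℝ) + 1)) := by fun_prop
    exact ((hS.comp continuous_snd).mul (((continuous_slopeNormal e).comp
      (h2.comp continuous_fst)).cross (Φ.continuous.comp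
        (e.symm.continuous.comp h3))).norm).aestronglyMeasurable
  · exact (integrable_indicator_iff hcpt.measurableSet).2
      (integrableOn_const hcpt.measure_lt_top.ne)
  · refine .of_forall fun q ↦ ?_
    by_cases hq : q ∈ B
    · rw [indicator_of_mem hq, norm_mul, norm_norm]
      refine mul_le_mul (hD _ hq.2) ((norm_cross_le _ _).trans ?_) (norm_nonneg _)
        ((norm_nonneg _).trans (hD _ hq.2))
      gcongr
      · exact hN _ (norm_fderiv_le_of_lipschitz ℝ (hK k))
      · exact hC _
    · rw [indicator_of_notMem hq]
      by_cases hq2 : q.2 ∈ Icc (0 : ℝ) 1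
      · have : e.symm (q.1, G k q.1 + q.2 / ((k : ℝ) + 1)) ∉ tsupport Φ := fun h ↦
          hq ⟨⟨_, ⟨_, h, rfl⟩, by simp⟩, hq2⟩
        simp [image_eq_zero_of_notMem_tsupport this, ← crossL_apply]
      · simp [deriv_smoothTransition_of_notMem hq2]
  · rw [Measure.volume_eq_prod]
    filter_upwards [Measure.quasiMeasurePreserving_fst.ae hfd] with q hq
    rw [mul_comm]
    refine Tendsto.const_mul _ (Tendsto.norm ?_)
    have h1 : Tendsto (fun k : ℕ ↦ q.2 * (1 / ((k : ℝ) + 1))) atTop (𝓝 (q.2 * 0)) :=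
      tendsto_one_div_add_atTop_nhds_zero_nat.const_mul _
    have h2 : Tendsto (fun k : ℕ ↦ G k q.1 + q.2 / ((k : ℝ) + 1)) atTop (𝓝 (g q.1)) := by
      simpa [div_eq_mul_inv] using (hlim q.1).add h1
    have h3 : Tendsto (fun k : ℕ ↦ e.symm (q.1, G k q.1 + q.2 / ((k : ℝ) + 1))) atTop
        (𝓝 (e.symm (q.1, g q.1))) :=
      (e.symm.continuous.tendsto _).comp (tendsto_const_nhds.prodMk_nhds h2)
    exact (((continuous_slopeNormal e).tendsto _).comp hq).cross ((Φ.continuous.tendsto _).comp h3)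

/-- If `V` is the open supergraph of a Lipschitz function near the support of `Φ`, then the boundary
pairing is controlled by the tangential part of `Φ` along the graph. -/
theorem abs_boundaryForm_le_of_graph (hμ : HasCurlMeasure Ω F μ) (hF : BoundedOn Ω F M)
    (hM : 0 ≤ M) (hV : MeasurableSet V) (hVΩ : V ⊆ Ω) {e : R3 ≃L[ℝ] E2 × ℝ}
    (he : MeasurePreserving e volume volume) {g : E2 → ℝ} {K : ℝ≥0} (hg : LipschitzWith K g)
    (Φ : 𝓓^{1}(Ω, R3)) (hΦ : ∀ x ∈ tsupport Φ, x ∈ V ↔ g (e x).1 < (e x).2) :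
    |boundaryForm V F μ Φ| ≤ M * (transitionMass *
      ∫ p, ‖cross (slopeNormal e (fderiv ℝ g p)) (Φ (e.symm (p, g p)))‖) := by
  have := hμ.finite_variation
  obtain ⟨u, hu, huK, hulim, hfd, -⟩ := exists_contDiff_lipschitz_approx hg
  -- The added constant is the bound for the mollification error. It lifts `G k` to or above `g`, so
  -- the cutoff vanishes at points of the support outside `V`.
  let G : ℕ → E2 → ℝ := fun k p ↦ u k p + K * (1 / ((k : ℝ) + 1))
  have hr : Tendsto (fun k : ℕ ↦ (K : ℝ) * (1 / ((k : ℝ) + 1))) atTop (𝓝 0) := by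
    simpa using (tendsto_one_div_add_atTop_nhds_zero_nat (𝕜 := ℝ)).const_mul (K : ℝ)
  have hGg : ∀ k p, g p ≤ G k p := fun k p ↦ by
    have := (abs_le.1 (hulim k p)).1
    simp only [G]
    linarith
  have hGlim : ∀ p, Tendsto (fun k ↦ G k p) atTop (𝓝 (g p)) := fun p ↦ by
    have : Tendsto (fun k ↦ u k p) atTop (𝓝 (g p)) :=
      tendsto_iff_norm_sub_tendsto_zero.2
        (squeeze_zero (fun _ ↦ norm_nonneg _) (fun k ↦ hulim k p) hr)
    simpa [G] using this.add hr
  have hG1 : ∀ k, ContDiff ℝ 1 (G k) := fun k ↦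
    ((hu k).of_le (by exact_mod_cast le_top)).add contDiff_const
  have hGK : ∀ k, LipschitzWith K (G k) := fun k ↦ by
    refine LipschitzWith.of_dist_le_mul fun p q ↦ ?_
    simpa [G] using (huK k).dist_le_mul p q
  have hGfd : ∀ᵐ p, Tendsto (fun k ↦ fderiv ℝ (G k) p) atTop (𝓝 (fderiv ℝ g p)) := by
    filter_upwards [hfd] with p hp
    simpa [G, fderiv_add_const] using hp
  have hkpos : ∀ k : ℕ, (0 : ℝ) < (k : ℝ) + 1 := fun k ↦ by positivity
  have hbase : ∀ k : ℕ, _ := fun k ↦ abs_cutoff_error_le hμ hF hM hV hVΩ he (hG1 k) (hkpos k) Φ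
    fun x hx hxV ↦ (not_lt.1 fun h ↦ hxV ((hΦ x hx).2 h)).trans (hGg k _)
  -- At a point strictly above the graph the argument of the transition tends to infinity, so the
  -- cutoff is eventually equal to one.
  have hcut : ∀ x, g (e x).1 < (e x).2 →
      Tendsto (fun k : ℕ ↦ graphCutoff e ((k : ℝ) + 1) (G k) x) atTop (𝓝 1) := fun x hx ↦ by
    have h1 : Tendsto (fun k : ℕ ↦ ((k : ℝ) + 1) * ((e x).2 - G k (e x).1)) atTop atTop :=
      (tendsto_natCast_atTop_atTop.atTop_add tendsto_const_nhds).atTop_mul_pos (sub_pos.2 hx)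
        (tendsto_const_nhds.sub (hGlim _))
    refine tendsto_const_nhds.congr' ?_
    filter_upwards [h1.eventually_ge_atTop 1] with k hk
    exact (Real.smoothTransition.one_of_one_le hk).symm
  have hcut1 : ∀ k x, ‖graphCutoff e ((k : ℕ) + 1 : ℝ) (G k) x‖ ≤ 1 := fun k x ↦ by
    rw [graphCutoff, Real.norm_of_nonneg (Real.smoothTransition.nonneg _)]
    exact Real.smoothTransition.le_one _
  have hptw : ∀ {X : Type} [NormedAddCommGroup X] [NormedSpace ℝ X] (h : R3 → X),
      (∀ x ∉ tsupport Φ, h x = 0) → ∀ x ∈ V,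
        Tendsto (fun k : ℕ ↦ graphCutoff e ((k : ℝ) + 1) (G k) x • h x) atTop (𝓝 (h x)) := by
    intro X _ _ h hh x hx
    by_cases hxs : x ∈ tsupport Φ
    · simpa using (hcut x ((hΦ x hxs).1 hx)).smul_const (h x)
    · simp [hh x hxs]
  obtain ⟨C, hC⟩ := Φ.continuous.bounded_above_of_compact_support Φ.hasCompactSupport
  have hJ := tendsto_setIntegral_vectorMeasure (μ := μ) hV
    (fun k ↦ (smulTest (contDiff_graphCutoff e ((k : ℝ) + 1) (hG1 k)) Φ).continuous) (C := C)
    (fun k x ↦ by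
      rw [smulTest_apply, norm_smul]
      exact (mul_le_of_le_one_left (norm_nonneg _) (hcut1 k x)).trans (hC x))
    (hptw Φ fun x hx ↦ image_eq_zero_of_notMem_tsupport hx)
  have hFV := hF.mono hVΩ
  have hint := hFV.integrable_inner (integrable_curl Φ.contDiff Φ.hasCompactSupport)
  have hI : Tendsto (fun k : ℕ ↦ ∫ x in V, graphCutoff e ((k : ℝ) + 1) (G k) x * ⟪curl Φ x, F x⟫)
      atTop (𝓝 (∫ x in V, ⟪curl Φ x, F x⟫)) := by
    refine tendsto_integral_of_dominated_convergence (fun x ↦ ‖⟪curl Φ x, F x⟫‖) (fun k ↦ ?_)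
      hint.norm (fun k ↦ .of_forall fun x ↦ ?_) ?_
    · exact (contDiff_graphCutoff e _ (hG1 k)).continuous.aestronglyMeasurable.mul
        hint.aestronglyMeasurable
    · rw [norm_mul]
      exact mul_le_of_le_one_left (norm_nonneg _) (hcut1 k x)
    · refine (ae_restrict_iff' hV).2 (.of_forall ?_)
      exact hptw (fun x ↦ ⟪curl Φ x, F x⟫) fun x hx ↦ by
        simp [curl_eq_zero_of_notMem_tsupport hx]
  exact le_of_tendsto_of_tendsto' (hJ.sub hI).abs
    ((tendsto_layerIntegral hG1 hGK hGlim hGfd Φ).const_mul M) hbase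

end GraphEstimate

/-! ### Lipschitz charts and surface measure -/

/-- The parametrization of the graph of `g` in the coordinates `e`. -/
noncomputable def graphMap (e : R3 ≃L[ℝ] E2 × ℝ) (g : E2 → ℝ) (p : E2) : R3 := e.symm (p, g p)

@[simp] lemma apply_graphMap (e : R3 ≃L[ℝ] E2 × ℝ) (g : E2 → ℝ) (p : E2) :
    e (graphMap e g p) = (p, g p) := by simp [graphMap]

/-- In the open set `W`, the set `V` is the strict supergraph of a Lipschitz function and `S` is its
graph, in suitable volume preserving linear coordinates. -/
structure IsLocalGraph (V S W : Set R3) (e : R3 ≃L[ℝ] E2 × ℝ) (g : E2 → ℝ) (K : ℝ≥0) : Prop where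
  measurePreserving : MeasurePreserving e volume volume
  norm_fst_le : ∀ x, ‖(e x).1‖ ≤ ‖x‖
  lipschitz : LipschitzWith K g
  isOpen : IsOpen W
  isBounded : Bornology.IsBounded W
  mem_iff : ∀ x ∈ W, x ∈ V ↔ g (e x).1 < (e x).2
  mem_surface_iff : ∀ x ∈ W, x ∈ S ↔ (e x).2 = g (e x).1

lemma euclideanHausdorffMeasure_image_le {X Y : Type*} [MetricSpace X] [MeasurableSpace X]
    [BorelSpace X] [MetricSpace Y] [MeasurableSpace Y] [BorelSpace Y] {f : X → Y} {C : ℝ≥0}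
    (hf : LipschitzWith C f) (d : ℕ) (s : Set X) :
    (μHE[d] : Measure Y) (f '' s) ≤ (C : ℝ≥0∞) ^ d * (μHE[d] : Measure X) s := by
  have h := hf.hausdorffMeasure_image_le (d := d) (by positivity) s
  rw [Measure.euclideanHausdorffMeasure_def, Measure.euclideanHausdorffMeasure_def,
    Measure.smul_apply, Measure.smul_apply, ENNReal.smul_def, ENNReal.smul_def, smul_eq_mul,
    smul_eq_mul, mul_left_comm]
  gcongr
  simpa using h

lemma exists_lipschitzWith_graphMap (e : R3 ≃L[ℝ] E2 × ℝ) {g : E2 → ℝ} {K : ℝ≥0}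
    (hg : LipschitzWith K g) : ∃ C, LipschitzWith C (graphMap e g) :=
  ⟨_, e.symm.lipschitz.comp (LipschitzWith.id.prodMk hg)⟩

namespace IsLocalGraph

variable {V S W : Set R3} {e : R3 ≃L[ℝ] E2 × ℝ} {g : E2 → ℝ} {K : ℝ≥0}

lemma graphMap_fst (h : IsLocalGraph V S W e g K) {x : R3} (hx : x ∈ W) (hxS : x ∈ S) :
    graphMap e g (e x).1 = x := by
  rw [graphMap, ← (h.mem_surface_iff x hx).1 hxS]
  simp

lemma graphMap_mem (h : IsLocalGraph V S W e g K) {p : E2} (hp : graphMap e g p ∈ W) :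
    graphMap e g p ∈ S :=
  (h.mem_surface_iff _ hp).2 (by simp)

lemma continuous_graphMap (h : IsLocalGraph V S W e g K) : Continuous (graphMap e g) :=
  e.symm.continuous.comp (continuous_id.prodMk h.lipschitz.continuous)

lemma lipschitzWith_fst (h : IsLocalGraph V S W e g K) : LipschitzWith 1 fun x ↦ (e x).1 := by
  refine LipschitzWith.of_dist_le_mul fun x y ↦ ?_
  have := h.norm_fst_le (x - y)
  simpa [dist_eq_norm] using this

/-- The preimage lies in the horizontal projection of `A`, and this projection is 1-Lipschitz, so it
does not increase two-dimensional measure. -/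
lemma volume_preimage_le (h : IsLocalGraph V S W e g K) (A : Set R3) :
    volume (graphMap e g ⁻¹' A) ≤ (μHE[2] : Measure R3) A := by
  have h1 := euclideanHausdorffMeasure_image_le h.lipschitzWith_fst 2 A
  rw [EuclideanSpace.euclideanHausdorffMeasure_eq_volume] at h1
  refine (measure_mono fun p hp ↦ ?_).trans (h1.trans_eq (by simp))
  exact ⟨_, hp, by simp⟩

/-- The Lebesgue measure in a chart is dominated by the surface measure. -/
lemma map_volume_le (h : IsLocalGraph V S W e g K) :
    (volume.restrict (graphMap e g ⁻¹' W)).map (graphMap e g) ≤ μHE[2].restrict S := by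
  refine Measure.le_iff.2 fun A hA ↦ ?_
  have hm := h.continuous_graphMap.measurable
  rw [Measure.map_apply hm hA, Measure.restrict_apply (hm hA), Measure.restrict_apply hA]
  have : graphMap e g ⁻¹' A ∩ graphMap e g ⁻¹' W ⊆ graphMap e g ⁻¹' (A ∩ S) :=
    fun p hp ↦ ⟨hp.1, h.graphMap_mem hp.2⟩
  exact (measure_mono this).trans (h.volume_preimage_le _)

lemma setIntegral_comp_graphMap_le (h : IsLocalGraph V S W e g K) {f : R3 → ℝ}
    (hf : IntegrableOn f S μHE[2]) (h0 : ∀ x, 0 ≤ f x) :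
    ∫ p in graphMap e g ⁻¹' W, f (graphMap e g p) ≤ ∫ x in S, f x ∂μHE[2] := by
  rw [← integral_map h.continuous_graphMap.aemeasurable
    (hf.aestronglyMeasurable.mono_measure h.map_volume_le)]
  exact integral_mono_measure h.map_volume_le (.of_forall h0) hf

lemma integrableOn_comp_graphMap (h : IsLocalGraph V S W e g K) {E : Type*}
    [NormedAddCommGroup E] {f : R3 → E} (hf : IntegrableOn f S μHE[2]) :
    IntegrableOn (fun p ↦ f (graphMap e g p)) (graphMap e g ⁻¹' W) := by
  have := Integrable.mono_measure hf h.map_volume_le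
  exact this.comp_measurable h.continuous_graphMap.measurable

/-- The surface piece is a Lipschitz image of a bounded planar set. -/
lemma measure_inter_lt_top (h : IsLocalGraph V S W e g K) : (μHE[2] : Measure R3) (S ∩ W) < ∞ := by
  obtain ⟨C, hC⟩ := exists_lipschitzWith_graphMap e h.lipschitz
  have h1 := euclideanHausdorffMeasure_image_le hC 2 ((fun x ↦ (e x).1) '' W)
  rw [EuclideanSpace.euclideanHausdorffMeasure_eq_volume] at h1
  have h2 : volume ((fun x ↦ (e x).1) '' W) < ∞ :=
    (h.lipschitzWith_fst.isBounded_image h.isBounded).measure_lt_top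
  refine (measure_mono ?_).trans_lt (h1.trans_lt (ENNReal.mul_lt_top (by simp) h2))
  exact fun x hx ↦ ⟨_, ⟨x, hx.2, rfl⟩, h.graphMap_fst hx.2 hx.1⟩

/-- A property that holds almost everywhere in the chart holds almost everywhere on the surface. -/
lemma ae_of_ae_fst (h : IsLocalGraph V S W e g K) {P : E2 → Prop} (hP : ∀ᵐ p, P p) :
    ∀ᵐ x ∂(μHE[2] : Measure R3), x ∈ S → x ∈ W → P (e x).1 := by
  obtain ⟨C, hC⟩ := exists_lipschitzWith_graphMap e h.lipschitz
  have h1 := euclideanHausdorffMeasure_image_le hC 2 {p | ¬ P p}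
  rw [EuclideanSpace.euclideanHausdorffMeasure_eq_volume, ae_iff.1 hP, mul_zero] at h1
  refine measure_mono_null (fun x hx ↦ ?_) (le_antisymm h1 zero_le)
  have hx' : ¬ (x ∈ S → x ∈ W → P (e x).1) := hx
  push Not at hx'
  exact ⟨_, hx'.2.2, h.graphMap_fst hx'.2.1 hx'.1⟩

end IsLocalGraph

section Cutoff

open scoped Manifold ContDiff

/-- Having `η = 1` near `A`, and not only on it, keeps the support of `1 - η` away from `A`. -/
lemma exists_contDiff_cutoff {A W : Set R3} (hA : IsClosed A) (hW : IsOpen W) (hAW : A ⊆ W) :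
    ∃ η : R3 → ℝ, ContDiff ℝ 1 η ∧ tsupport η ⊆ W ∧ (∀ᶠ x in 𝓝ˢ A, η x = 1) ∧
      ∀ x, η x ∈ Icc (0 : ℝ) 1 := by
  obtain ⟨f, h0, h1, hf⟩ := exists_contMDiffMap_zero_one_nhds_of_isClosed 𝓘(ℝ, R3) (n := 1)
    hW.isClosed_compl hA (disjoint_left.2 fun x hx hxA ↦ hx (hAW hxA))
  refine ⟨f, f.contMDiff.contDiff, fun x hx ↦ ?_, h1, hf⟩
  by_contra hxW
  exact notMem_tsupport_iff_eventuallyEq.2 (h0.filter_mono (nhds_le_nhdsSet hxW)) hx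

end Cutoff

/-- `S ⊆ Ω` is a compact Lipschitz surface containing the part of the frontier of `V` in `Ω`, and `V`
lies on one side of `S` locally. -/
structure IsLipschitzSide (Ω : TopologicalSpace.Opens R3) (V S : Set R3) : Prop where
  isOpen : IsOpen V
  subset : V ⊆ Ω
  isCompact : IsCompact S
  surface_subset : S ⊆ Ω
  frontier_subset : frontier V ∩ Ω ⊆ S
  exists_chart : ∀ x ∈ S, ∃ W e g K, x ∈ W ∧ IsLocalGraph V S W e g K

/-! ### From charts to a global L¹ bound -/

section GlobalBound

variable {Ω : TopologicalSpace.Opens R3} {F : R3 → R3} {M : ℝ} {μ : VectorMeasure R3 R3}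
  {V S : Set R3}

lemma IsLipschitzSide.measure_lt_top (h : IsLipschitzSide Ω V S) :
    (μHE[2] : Measure R3) S < ∞ := by
  refine h.isCompact.measure_lt_top_of_nhdsWithin fun x hx ↦ ?_
  obtain ⟨W, e, g, K, hxW, hW⟩ := h.exists_chart x hx
  refine ⟨S ∩ W, inter_mem self_mem_nhdsWithin (mem_nhdsWithin_of_mem_nhds
    (hW.isOpen.mem_nhds hxW)), hW.measure_inter_lt_top⟩

lemma IsLipschitzSide.isFiniteMeasure (h : IsLipschitzSide Ω V S) :
    IsFiniteMeasure ((μHE[2] : Measure R3).restrict S) :=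
  isFiniteMeasure_restrict.2 h.measure_lt_top.ne

lemma IsLipschitzSide.integrable (h : IsLipschitzSide Ω V S) {E : Type*} [NormedAddCommGroup E]
    {f : R3 → E} (hf : Continuous f) : IntegrableOn f S (μHE[2] : Measure R3) := by
  have := h.isFiniteMeasure
  obtain ⟨C, hC⟩ := h.isCompact.exists_bound_of_continuousOn hf.continuousOn
  exact Integrable.of_bound hf.aestronglyMeasurable C
    (ae_restrict_of_forall_mem h.isCompact.measurableSet hC)

lemma IsLocalGraph.exists_norm_slopeNormal_fderiv_le {W : Set R3} {e : R3 ≃L[ℝ] E2 × ℝ}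
    {g : E2 → ℝ} {K : ℝ≥0} (hW : IsLocalGraph V S W e g K) :
    ∃ C, 0 ≤ C ∧ ∀ p, ‖slopeNormal e (fderiv ℝ g p)‖ ≤ C := by
  obtain ⟨C, hC0, hC⟩ := exists_norm_slopeNormal_le e K
  exact ⟨C, hC0, fun p ↦ hC _ (norm_fderiv_le_of_lipschitz ℝ hW.lipschitz)⟩

/-- In a chart, the boundary pairing is controlled by the tangential part of the field. -/
lemma IsLipschitzSide.abs_boundaryForm_le_tangential (h : IsLipschitzSide Ω V S)
    (hμ : HasCurlMeasure Ω F μ) (hF : BoundedOn Ω F M) (hM : 0 ≤ M) {W : Set R3}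
    {e : R3 ≃L[ℝ] E2 × ℝ} {g : E2 → ℝ} {K : ℝ≥0} (hW : IsLocalGraph V S W e g K)
    (Φ : 𝓓^{1}(Ω, R3)) (hΦ : tsupport Φ ⊆ W) :
    |boundaryForm V F μ Φ| ≤ M * (transitionMass * ∫ p in graphMap e g ⁻¹' W,
      ‖cross (slopeNormal e (fderiv ℝ g p)) (Φ (graphMap e g p))‖) := by
  rw [setIntegral_eq_integral_of_forall_compl_eq_zero fun p hp ↦ ?_]
  · exact abs_boundaryForm_le_of_graph hμ hF hM h.isOpen.measurableSet h.subset
      hW.measurePreserving hW.lipschitz Φ fun x hx ↦ hW.mem_iff x (hΦ hx)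
  · rw [image_eq_zero_of_notMem_tsupport fun hp' ↦ hp (hΦ hp')]
    simp [← crossL_apply]

/-- The boundary pairing of `F` is bounded by the `L¹` norm on `S` for fields supported in `W`. -/
def HasBoundaryBound (Ω : TopologicalSpace.Opens R3) (V S : Set R3) (F : R3 → R3)
    (μ : VectorMeasure R3 R3) (W : Set R3) : Prop :=
  ∃ C, 0 ≤ C ∧ ∀ Φ : 𝓓^{1}(Ω, R3), tsupport Φ ⊆ W →
    |boundaryForm V F μ Φ| ≤ C * ∫ x in S, ‖Φ x‖ ∂μHE[2]

lemma IsLipschitzSide.hasBoundaryBound_chart (h : IsLipschitzSide Ω V S)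
    (hμ : HasCurlMeasure Ω F μ) (hF : BoundedOn Ω F M) (hM : 0 ≤ M) {W : Set R3}
    {e : R3 ≃L[ℝ] E2 × ℝ} {g : E2 → ℝ} {K : ℝ≥0} (hW : IsLocalGraph V S W e g K) :
    HasBoundaryBound Ω V S F μ W := by
  obtain ⟨N, hN0, hN⟩ := hW.exists_norm_slopeNormal_fderiv_le
  refine ⟨M * (transitionMass * (‖crossL‖ * N)), mul_nonneg hM
    (mul_nonneg transitionMass_nonneg (by positivity)), fun Φ hΦ ↦ ?_⟩
  refine (h.abs_boundaryForm_le_tangential hμ hF hM hW Φ hΦ).trans ?_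
  have hint : IntegrableOn (fun x ↦ ‖Φ x‖) S (μHE[2] : Measure R3) :=
    h.integrable Φ.continuous.norm
  have h1 : ∫ p in graphMap e g ⁻¹' W, ‖cross (slopeNormal e (fderiv ℝ g p)) (Φ (graphMap e g p))‖
      ≤ (‖crossL‖ * N) * ∫ x in S, ‖Φ x‖ ∂μHE[2] := by
    refine le_trans ?_ (mul_le_mul_of_nonneg_left
      (hW.setIntegral_comp_graphMap_le hint fun x ↦ norm_nonneg _) (by positivity))
    rw [← integral_const_mul]
    refine integral_mono_of_nonneg (.of_forall fun p ↦ norm_nonneg _)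
      ((hW.integrableOn_comp_graphMap hint).const_mul _) (.of_forall fun p ↦ ?_)
    refine (norm_cross_le _ _).trans ?_
    beta_reduce
    gcongr
    exact hN p
  exact (mul_le_mul_of_nonneg_left (mul_le_mul_of_nonneg_left h1 transitionMass_nonneg) hM).trans_eq
    (by ring)

/-- The support of `Φ` misses the frontier of `V`, so truncating `Φ` to `V` again gives a C¹ test
field on `Ω`, to which the curl identity applies. -/
lemma IsLipschitzSide.boundaryForm_eq_zero_of_disjoint (h : IsLipschitzSide Ω V S)
    (hμ : HasCurlMeasure Ω F μ) (hF : BoundedOn Ω F M) (Φ : 𝓓^{1}(Ω, R3))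
    (hΦ : Disjoint (tsupport Φ) S) : boundaryForm V F μ Φ = 0 := by
  have hin : ∀ x ∈ V, V.indicator Φ =ᶠ[𝓝 x] Φ := fun x hx ↦ by
    filter_upwards [h.isOpen.mem_nhds hx] with y hy using indicator_of_mem hy _
  have hout : ∀ x ∉ V, V.indicator Φ =ᶠ[𝓝 x] 0 := fun x hx ↦ by
    by_cases hxs : x ∈ tsupport Φ
    · have hcl : x ∉ closure V := fun hc ↦ disjoint_left.1 hΦ hxs (h.frontier_subset
        ⟨⟨hc, by rwa [h.isOpen.interior_eq]⟩, Φ.tsupport_subset hxs⟩)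
      filter_upwards [isClosed_closure.isOpen_compl.mem_nhds hcl] with y hy
      exact indicator_of_notMem (fun hy' ↦ hy (subset_closure hy')) _
    · filter_upwards [notMem_tsupport_iff_eventuallyEq.1 hxs] with y hy
      simp [hy]
  have hsub : Function.support (V.indicator Φ) ⊆ Function.support Φ :=
    fun x hx hx0 ↦ hx (by simp [hx0])
  let Ψ : 𝓓^{1}(Ω, R3) :=
    { toFun := V.indicator Φ
      contDiff' := contDiff_iff_contDiffAt.2 fun x ↦ by
        by_cases hx : x ∈ V
        · exact Φ.contDiff.contDiffAt.congr_of_eventuallyEq (hin x hx)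
        · exact (contDiffAt_const (c := (0 : R3))).congr_of_eventuallyEq (hout x hx)
      hasCompactSupport' := Φ.hasCompactSupport.mono hsub
      tsupport_subset' := (closure_mono hsub).trans Φ.tsupport_subset }
  have hΨ : ∀ x, Ψ x = V.indicator Φ x := fun _ ↦ rfl
  have hcurl_in : ∀ x ∈ V, curl Ψ x = curl Φ x := fun x hx ↦ by
    have : fderiv ℝ Ψ x = fderiv ℝ Φ x := (hin x hx).fderiv_eq
    rw [curl_eq, curl_eq, this]
  have hcurl_out : ∀ x ∉ V, curl Ψ x = 0 := fun x hx ↦ by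
    have : fderiv ℝ Ψ x = 0 := (hout x hx).fderiv_eq.trans (by simp)
    rw [curl_eq, this, map_zero]
  have h1 : boundaryForm V F μ Φ = boundaryForm V F μ Ψ := by
    rw [boundaryForm, boundaryForm]
    congr 1
    · exact VectorMeasure.setIntegral_congr_fun fun x hx ↦ by rw [hΨ, indicator_of_mem hx]
    · exact setIntegral_congr_fun h.isOpen.measurableSet fun x hx ↦ by
        simp only [hcurl_in x hx]
  rw [h1, boundaryForm_eq_of_eqOn_zero h.isOpen.measurableSet h.subset
    (fun x hx ↦ by rw [hΨ, indicator_of_notMem hx.2]) fun x hx ↦ hcurl_out x hx.2]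
  exact hμ.boundaryForm_eq_zero hF Ψ

/-- Split `Φ` as `ηΦ + (1 - η)Φ`. The bound involves only values of the field and both weights are
at most one, so the constants add and no derivative of `η` enters. -/
lemma IsLipschitzSide.hasBoundaryBound_union (h : IsLipschitzSide Ω V S)
    [IsFiniteMeasure μ.variation] (hF : BoundedOn Ω F M) {W₁ W₂ : Set R3} (hW₁ : IsOpen W₁)
    (hW₂ : IsOpen W₂) (h₁ : HasBoundaryBound Ω V S F μ W₁)
    (h₂ : HasBoundaryBound Ω V S F μ W₂) : HasBoundaryBound Ω V S F μ (W₁ ∪ W₂) := by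
  obtain ⟨C₁, hC₁0, hC₁⟩ := h₁
  obtain ⟨C₂, hC₂0, hC₂⟩ := h₂
  refine ⟨C₁ + C₂, add_nonneg hC₁0 hC₂0, fun Φ hΦ ↦ ?_⟩
  obtain ⟨η, hη, hηs, hη1, hη01⟩ := exists_contDiff_cutoff
    ((isClosed_tsupport Φ).sdiff hW₂) hW₁ fun x hx ↦ (hΦ hx.1).resolve_right hx.2
  have hη' : ContDiff ℝ 1 fun x ↦ 1 - η x := contDiff_const.sub hη
  have hsum : Φ = smulTest hη Φ + smulTest hη' Φ := by
    ext1 x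
    change Φ x = η x • Φ x + (1 - η x) • Φ x
    module
  have hs₁ : tsupport (smulTest hη Φ) ⊆ W₁ :=
    (tsupport_smul_subset_left η Φ).trans hηs
  have hs₂ : tsupport (smulTest hη' Φ) ⊆ W₂ := fun x hx ↦ by
    have hxΦ : x ∈ tsupport Φ := tsupport_smul_subset_right (fun x ↦ 1 - η x) Φ hx
    by_contra hxW
    have := hη1.filter_mono (nhds_le_nhdsSet (s := tsupport Φ \ W₂) ⟨hxΦ, hxW⟩)
    refine notMem_tsupport_iff_eventuallyEq.2 ?_ hx
    filter_upwards [this] with y hy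
    simp [hy]
  have hle : ∀ Ψ : 𝓓^{1}(Ω, R3), (∀ x, ‖Ψ x‖ ≤ ‖Φ x‖) →
      ∫ x in S, ‖Ψ x‖ ∂μHE[2] ≤ ∫ x in S, ‖Φ x‖ ∂μHE[2] := fun Ψ hΨ ↦
    integral_mono (h.integrable Ψ.continuous.norm) (h.integrable Φ.continuous.norm) hΨ
  have hb₁ := hle (smulTest hη Φ) fun x ↦ by
    rw [smulTest_apply, norm_smul, Real.norm_of_nonneg (hη01 x).1]
    exact mul_le_of_le_one_left (norm_nonneg _) (hη01 x).2
  have hb₂ := hle (smulTest hη' Φ) fun x ↦ by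
    rw [smulTest_apply, norm_smul, Real.norm_of_nonneg (sub_nonneg.2 (hη01 x).2)]
    exact mul_le_of_le_one_left (norm_nonneg _) (by linarith [(hη01 x).1])
  have hadd := boundaryForm_add (μ := μ) (hF.mono h.subset) (smulTest hη Φ) (smulTest hη' Φ)
  rw [← hsum] at hadd
  rw [hadd, add_mul]
  exact (abs_add_le _ _).trans (add_le_add
    ((hC₁ _ hs₁).trans (mul_le_mul_of_nonneg_left hb₁ hC₁0))
    ((hC₂ _ hs₂).trans (mul_le_mul_of_nonneg_left hb₂ hC₂0)))

/-- The boundary pairing is bounded by the `L¹` norm on the surface. -/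
theorem IsLipschitzSide.exists_abs_boundaryForm_le (h : IsLipschitzSide Ω V S)
    (hμ : HasCurlMeasure Ω F μ) (hF : BoundedOn Ω F M) (hM : 0 ≤ M) :
    ∃ C, 0 ≤ C ∧ ∀ Φ : 𝓓^{1}(Ω, R3),
      |boundaryForm V F μ Φ| ≤ C * ∫ x in S, ‖Φ x‖ ∂μHE[2] := by
  have := hμ.finite_variation
  have hnear : ∃ W, IsOpen W ∧ S ⊆ W ∧ HasBoundaryBound Ω V S F μ W := by
    refine h.isCompact.induction_on
      (p := fun s ↦ ∃ W, IsOpen W ∧ s ⊆ W ∧ HasBoundaryBound Ω V S F μ W) ?_ ?_ ?_ ?_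
    · refine ⟨∅, isOpen_empty, subset_rfl, 0, le_rfl, fun Φ hΦ ↦ ?_⟩
      rw [h.boundaryForm_eq_zero_of_disjoint hμ hF Φ (by simp [subset_empty_iff.1 hΦ])]
      simp
    · exact fun s t hst ⟨W, hWo, htW, hW⟩ ↦ ⟨W, hWo, hst.trans htW, hW⟩
    · exact fun s t ⟨W₁, ho₁, hs, h₁⟩ ⟨W₂, ho₂, ht, h₂⟩ ↦ ⟨W₁ ∪ W₂, ho₁.union ho₂,
        union_subset_union hs ht, h.hasBoundaryBound_union hF ho₁ ho₂ h₁ h₂⟩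
    · intro x hx
      obtain ⟨W, e, g, K, hxW, hW⟩ := h.exists_chart x hx
      exact ⟨W, mem_nhdsWithin_of_mem_nhds (hW.isOpen.mem_nhds hxW), W, hW.isOpen, subset_rfl,
        h.hasBoundaryBound_chart hμ hF hM hW⟩
  obtain ⟨W, hWo, hSW, hW⟩ := hnear
  have haway : HasBoundaryBound Ω V S F μ Sᶜ := ⟨0, le_rfl, fun Φ hΦ ↦ by
    rw [h.boundaryForm_eq_zero_of_disjoint hμ hF Φ (disjoint_left.2 fun x hx ↦ hΦ hx)]
    simp⟩
  obtain ⟨C, hC0, hC⟩ := h.hasBoundaryBound_union hF hWo h.isCompact.isClosed.isOpen_compl hW haway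
  refine ⟨C, hC0, fun Φ ↦ hC Φ fun x _ ↦ ?_⟩
  by_cases hx : x ∈ S
  · exact .inl (hSW hx)
  · exact .inr hx

end GlobalBound

/-! ### Riesz representation and essential boundedness -/

section Riesz

lemma integral_norm_le_mul_norm_Lp {X E : Type*} [MeasurableSpace X] [NormedAddCommGroup E]
    (ν : Measure X) [IsFiniteMeasure ν] (f : Lp E 2 ν) :
    ∫ x, ‖f x‖ ∂ν ≤ (ν univ ^ (1 / 2 : ℝ)).toReal * ‖f‖ := by
  have he : 1 / (1 : ℝ≥0∞).toReal - 1 / (2 : ℝ≥0∞).toReal = (1 / 2 : ℝ) := by norm_num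
  have h1 := eLpNorm_le_eLpNorm_mul_rpow_measure_univ (p := 1) (q := 2) (μ := ν) one_le_two
    (Lp.aestronglyMeasurable f)
  rw [he] at h1
  have hfin : ν univ ^ (1 / 2 : ℝ) ≠ ∞ := by finiteness
  have h2 := ENNReal.toReal_mono (ENNReal.mul_ne_top (Lp.eLpNorm_ne_top f) hfin) h1
  rw [ENNReal.toReal_mul, eLpNorm_one_eq_lintegral_enorm,
    ← integral_norm_eq_lintegral_enorm (Lp.aestronglyMeasurable f)] at h2
  rwa [Lp.norm_def, mul_comm]

lemma continuous_integral_norm_Lp {X E : Type*} [MeasurableSpace X] [NormedAddCommGroup E]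
    (ν : Measure X) [IsFiniteMeasure ν] : Continuous fun f : Lp E 2 ν ↦ ∫ x, ‖f x‖ ∂ν := by
  refine LipschitzWith.continuous (K := (ν univ ^ (1 / 2 : ℝ)).toNNReal)
    (LipschitzWith.of_le_add_mul _ fun f g ↦ ?_)
  have hint : ∀ f : Lp E 2 ν, Integrable (fun x ↦ ‖f x‖) ν := fun f ↦
    ((Lp.memLp f).integrable one_le_two).norm
  rw [dist_eq_norm]
  refine le_trans ?_ (add_le_add_right (integral_norm_le_mul_norm_Lp ν (f - g)) _)
  rw [← integral_add (hint g) (hint (f - g))]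
  refine integral_mono_ae (hint f) ((hint g).add (hint (f - g))) ?_
  filter_upwards [Lp.coeFn_sub f g] with x hx
  rw [hx]
  simpa using norm_add_le (g x) (f x - g x)

/-- An `L²` field whose pairing with all `L²` fields is controlled by the `L¹` norm is bounded. -/
lemma ae_norm_le_of_abs_inner_le {X E : Type*} [MeasurableSpace X] [NormedAddCommGroup E]
    [InnerProductSpace ℝ E] {ν : Measure X} [IsFiniteMeasure ν] {C : ℝ} (hC : 0 ≤ C)
    (t : Lp E 2 ν) (ht : ∀ f : Lp E 2 ν, |⟪t, f⟫| ≤ C * ∫ x, ‖f x‖ ∂ν) :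
    ∀ᵐ x ∂ν, ‖t x‖ ≤ C := by
  -- Testing with `t` restricted to `A` gives ∫_A ‖t‖² ≤ C ∫_A ‖t‖, although ‖t‖² > C‖t‖ on `A`;
  -- hence `A` is null.
  set A := {x | C < ‖t x‖}
  have hA : MeasurableSet A :=
    measurableSet_lt measurable_const (Lp.stronglyMeasurable t).norm.measurable
  have htA := (Lp.memLp t).indicator hA
  have hcoe := htA.coeFn_toLp
  have h1 : Integrable (fun x ↦ ‖t x‖ ^ 2) ν := (Lp.memLp t).norm.integrable_sq
  have h2 : Integrable (fun x ↦ ‖t x‖) ν := ((Lp.memLp t).integrable one_le_two).norm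
  have e1 : ⟪t, htA.toLp _⟫ = ∫ x in A, ‖t x‖ ^ 2 ∂ν := by
    rw [L2.inner_def, ← integral_indicator hA]
    refine integral_congr_ae ?_
    filter_upwards [hcoe] with x hx
    rw [hx]
    by_cases hxA : x ∈ A <;> simp [hxA]
  have e2 : ∫ x, ‖htA.toLp _ x‖ ∂ν = ∫ x in A, ‖t x‖ ∂ν := by
    rw [← integral_indicator hA]
    refine integral_congr_ae ?_
    filter_upwards [hcoe] with x hx
    rw [hx, norm_indicator_eq_indicator_norm]
  have h3 : ∫ x in A, (‖t x‖ ^ 2 - C * ‖t x‖) ∂ν ≤ 0 := by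
    rw [integral_sub h1.integrableOn (h2.const_mul C).integrableOn, integral_const_mul, ← e1, ← e2]
    linarith [(le_abs_self _).trans (ht (htA.toLp _))]
  have hpos : ∀ x ∈ A, 0 < ‖t x‖ ^ 2 - C * ‖t x‖ := fun x hx ↦ by
    have hx : C < ‖t x‖ := hx
    nlinarith
  have h4 := (setIntegral_eq_zero_iff_of_nonneg_ae
    (ae_restrict_of_forall_mem hA fun x hx ↦ (hpos x hx).le)
    (h1.sub (h2.const_mul C)).integrableOn).1
    (le_antisymm h3 (setIntegral_nonneg hA fun x hx ↦ (hpos x hx).le))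
  filter_upwards [(ae_restrict_iff' hA).1 h4] with x hx
  by_contra hxC
  exact (hpos x (not_le.1 hxC)).ne' (hx (not_le.1 hxC))

variable {Ω : TopologicalSpace.Opens R3} {F : R3 → R3} {M : ℝ} {μ : VectorMeasure R3 R3}
  {V S : Set R3}

lemma IsLipschitzSide.memLp (h : IsLipschitzSide Ω V S) (Φ : 𝓓^{1}(Ω, R3)) :
    MemLp Φ 2 (μHE[2].restrict S) := by
  have := h.isFiniteMeasure
  obtain ⟨C, hC⟩ := Φ.continuous.bounded_above_of_compact_support Φ.hasCompactSupport
  exact MemLp.of_bound Φ.continuous.aestronglyMeasurable C (.of_forall hC)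

/-- Restriction of test fields to the surface. -/
noncomputable def IsLipschitzSide.restrictL2 (h : IsLipschitzSide Ω V S) :
    𝓓^{1}(Ω, R3) →ₗ[ℝ] Lp R3 2 ((μHE[2] : Measure R3).restrict S) where
  toFun Φ := (h.memLp Φ).toLp Φ
  map_add' _ _ := rfl
  map_smul' _ _ := rfl

lemma IsLipschitzSide.coeFn_restrictL2 (h : IsLipschitzSide Ω V S) (Φ : 𝓓^{1}(Ω, R3)) :
    h.restrictL2 Φ =ᵐ[(μHE[2] : Measure R3).restrict S] Φ :=
  (h.memLp Φ).coeFn_toLp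

lemma IsLipschitzSide.exists_cutoff (h : IsLipschitzSide Ω V S) :
    ∃ θ : R3 → ℝ, ContDiff ℝ 1 θ ∧ tsupport θ ⊆ Ω ∧ (∀ x ∈ S, θ x = 1) := by
  obtain ⟨θ, hθ, hs, h1, -⟩ := exists_contDiff_cutoff h.isCompact.isClosed Ω.isOpen h.surface_subset
  exact ⟨θ, hθ, hs, fun x hx ↦ h1.self_of_nhdsSet x hx⟩

lemma IsLipschitzSide.exists_testFunction_eqOn (h : IsLipschitzSide Ω V S) {g : R3 → R3}
    (hg : ContDiff ℝ 1 g) (hgc : HasCompactSupport g) :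
    ∃ Φ : 𝓓^{1}(Ω, R3), ∀ x ∈ S, Φ x = g x := by
  obtain ⟨θ, hθ, hs, h1⟩ := h.exists_cutoff
  exact ⟨cutoffTest hθ hs hg hgc, fun x hx ↦ by rw [cutoffTest_apply, h1 x hx, one_smul]⟩

/-- Smooth compactly supported fields are dense in L². Multiplying by a cutoff equal to one on `S`
moves the support into `Ω` without changing values on `S`. -/
lemma IsLipschitzSide.denseRange_restrictL2 (h : IsLipschitzSide Ω V S) :
    DenseRange h.restrictL2 := by
  have := h.isFiniteMeasure
  have hd := MeasureTheory.Lp.dense_hasCompactSupport_contDiff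
    (μ := (μHE[2] : Measure R3).restrict S) (F := R3) (p := 2) (by simp)
  refine hd.mono fun f hf ↦ ?_
  obtain ⟨g, hfg, hgc, hg⟩ := hf
  obtain ⟨Φ, hΦ⟩ := h.exists_testFunction_eqOn (hg.of_le (by exact_mod_cast le_top)) hgc
  refine ⟨Φ, Lp.ext ?_⟩
  filter_upwards [h.coeFn_restrictL2 Φ, hfg, ae_restrict_mem h.isCompact.measurableSet]
    with x hx hx' hxS
  rw [hx', hx, hΦ x hxS]

/-- Riesz representation of the boundary pairing. -/
theorem IsLipschitzSide.exists_density (h : IsLipschitzSide Ω V S)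
    (hμ : HasCurlMeasure Ω F μ) (hF : BoundedOn Ω F M) (hM : 0 ≤ M) :
    ∃ t : R3 → R3, StronglyMeasurable t ∧ (∃ C, ∀ᵐ x ∂μHE[2].restrict S, ‖t x‖ ≤ C) ∧
      ∀ Φ : 𝓓^{1}(Ω, R3), ∫ x in S, ⟪t x, Φ x⟫ ∂μHE[2] = boundaryForm V F μ Φ := by
  have := h.isFiniteMeasure
  have := hμ.finite_variation
  set ν := (μHE[2] : Measure R3).restrict S
  obtain ⟨C, hC0, hC⟩ := h.exists_abs_boundaryForm_le hμ hF hM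
  let ℓ : 𝓓^{1}(Ω, R3) →ₗ[ℝ] ℝ :=
    { toFun := fun Φ ↦ boundaryForm V F μ Φ
      map_add' := boundaryForm_add (hF.mono h.subset)
      map_smul' := boundaryForm_smul }
  have hcoe : ∀ Φ, h.restrictL2 Φ =ᵐ[ν] Φ := h.coeFn_restrictL2
  have hL1 : ∀ Φ, |ℓ Φ| ≤ C * ∫ x, ‖h.restrictL2 Φ x‖ ∂ν := fun Φ ↦ by
    refine (hC Φ).trans_eq ?_
    congr 1
    refine integral_congr_ae ?_
    filter_upwards [hcoe Φ] with x hx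
    rw [hx]
  have hbound : ∃ C', ∀ Φ, ‖ℓ Φ‖ ≤ C' * ‖h.restrictL2 Φ‖ :=
    ⟨C * (ν univ ^ (1 / 2 : ℝ)).toReal, fun Φ ↦ (hL1 Φ).trans (by
      rw [mul_assoc]
      exact mul_le_mul_of_nonneg_left (integral_norm_le_mul_norm_Lp ν _) hC0)⟩
  let T : Lp R3 2 ν →L[ℝ] ℝ := ℓ.extendOfNorm h.restrictL2
  have hT : ∀ Φ, T (h.restrictL2 Φ) = ℓ Φ :=
    ℓ.extendOfNorm_eq h.denseRange_restrictL2 hbound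
  let t : Lp R3 2 ν := (InnerProductSpace.toDual ℝ _).symm T
  have ht : ∀ f, ⟪t, f⟫ = T f := fun f ↦ InnerProductSpace.toDual_symm_apply
  refine ⟨t, Lp.stronglyMeasurable t, ⟨C, ae_norm_le_of_abs_inner_le hC0 t fun f ↦ ?_⟩,
    fun Φ ↦ ?_⟩
  · rw [ht]
    -- Both sides are continuous in L², so the L¹ bound passes from test fields to all of L².
    refine h.denseRange_restrictL2.induction_on
      (p := fun f ↦ |T f| ≤ C * ∫ x, ‖f x‖ ∂ν) f ?_ fun Φ ↦ ?_
    · exact isClosed_le T.continuous.abs (continuous_const.mul (continuous_integral_norm_Lp ν))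
    · rw [hT]
      exact hL1 Φ
  · change _ = ℓ Φ
    rw [← hT, ← ht, L2.inner_def]
    refine integral_congr_ae ?_
    filter_upwards [hcoe Φ] with x hx
    rw [hx]

end Riesz

/-! ### Tangent planes of Lipschitz graphs -/

section TangentPlane

variable {V S W : Set R3} {e : R3 ≃L[ℝ] E2 × ℝ} {g : E2 → ℝ} {K : ℝ≥0}

lemma slopeNormal_ne_zero (e : R3 ≃L[ℝ] E2 × ℝ) (A : E2 →L[ℝ] ℝ) : slopeNormal e A ≠ 0 := fun h ↦ by
  have := inner_slopeNormal e A (e.symm (0, 1))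
  simp [h] at this

/-- The tangent cone of a graph at a point of differentiability. -/
lemma IsLocalGraph.tangentConeAt_eq (h : IsLocalGraph V S W e g K) {x : R3} (hxS : x ∈ S)
    (hxW : x ∈ W) (hg : DifferentiableAt ℝ g (e x).1) :
    tangentConeAt ℝ S x = {v | ⟪slopeNormal e (fderiv ℝ g (e x).1), v⟫ = 0} := by
  have hWx : W ∈ 𝓝 x := h.isOpen.mem_nhds hxW
  have hx := h.graphMap_fst hxW hxS
  set A := fderiv ℝ g (e x).1 with hA
  have hgA : HasFDerivAt g A (e x).1 := hg.hasFDerivAt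
  rw [← tangentConeAt_inter_nhds hWx]
  refine Subset.antisymm (fun v hv ↦ ?_) fun v hv ↦ ?_
  -- The defining function vanishes on `S ∩ W`, so its derivative sends tangent vectors into the
  -- tangent cone of a single point, which is zero.
  · have he : HasFDerivAt e (e : R3 →L[ℝ] E2 × ℝ) x := e.hasFDerivAt
    have hH : HasFDerivAt (fun y ↦ (e y).2 - g (e y).1) (ContinuousLinearMap.snd ℝ E2 ℝ ∘L
        (e : R3 →L[ℝ] E2 × ℝ) - A ∘L ContinuousLinearMap.fst ℝ E2 ℝ ∘L (e : R3 →L[ℝ] E2 × ℝ)) x :=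
      he.snd.sub (hgA.comp x he.fst)
    have hm := hH.hasFDerivWithinAt.mapsTo_tangent_cone (s := S ∩ W) hv
    have hsub : (fun y ↦ (e y).2 - g (e y).1) '' (S ∩ W) ⊆ {0} := by
      rintro _ ⟨y, hy, rfl⟩
      simp [(h.mem_surface_iff y hy.2).1 hy.1]
    rw [(h.mem_surface_iff x hxW).1 hxS, sub_self] at hm
    have hacc : ¬ AccPt (0 : ℝ) (𝓟 {0}) := fun h ↦ by
      obtain ⟨y, hy, hy0⟩ := accPt_iff_nhds.1 h univ univ_mem
      exact hy0 hy.2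
    have h0 := tangentConeAt_subset_zero (𝕜 := ℝ) hacc (tangentConeAt_mono hsub hm)
    rw [mem_ofPred_eq, inner_slopeNormal]
    exact h0
  -- Conversely, `v` is the image of its horizontal part under the derivative of the
  -- parametrization, whose domain is open.
  · have hp : graphMap e g ⁻¹' W ∈ 𝓝 (e x).1 :=
      h.continuous_graphMap.continuousAt.preimage_mem_nhds (by rwa [hx])
    have hG : HasFDerivAt (graphMap e g)
        ((e.symm : E2 × ℝ →L[ℝ] R3) ∘L (ContinuousLinearMap.id ℝ E2).prod A) (e x).1 :=
      e.symm.hasFDerivAt.comp (e x).1 ((hasFDerivAt_id _).prodMk hgA)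
    have hT : (e v).1 ∈ tangentConeAt ℝ (graphMap e g ⁻¹' W) (e x).1 := by
      rw [tangentConeAt_of_mem_nhds hp]
      trivial
    have hm := hG.hasFDerivWithinAt.mapsTo_tangent_cone hT
    rw [hx] at hm
    have hv' : (e v).2 = A (e v).1 := by
      have : ⟪slopeNormal e A, v⟫ = 0 := hv
      rwa [inner_slopeNormal, sub_eq_zero] at this
    have hvv : e.symm ((e v).1, A (e v).1) = v := by rw [← hv']; simp
    have hm' : v ∈ tangentConeAt ℝ (graphMap e g '' (graphMap e g ⁻¹' W)) x := by
      rw [← hvv]; simpa using hm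
    refine tangentConeAt_mono ?_ hm'
    rintro _ ⟨p, hp, rfl⟩
    exact ⟨h.graphMap_mem hp, hp⟩

lemma IsLocalGraph.isTangentPlane (h : IsLocalGraph V S W e g K) {x : R3} (hxS : x ∈ S)
    (hxW : x ∈ W) (hg : DifferentiableAt ℝ g (e x).1) :
    IsTangentPlane S x (ℝ ∙ slopeNormal e (fderiv ℝ g (e x).1))ᗮ := by
  have : Fact (Module.finrank ℝ R3 = 2 + 1) := ⟨by simp⟩
  refine ⟨Submodule.finrank_orthogonal_span_singleton (slopeNormal_ne_zero _ _), ?_⟩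
  rw [h.tangentConeAt_eq hxS hxW hg]
  ext v
  exact Submodule.mem_orthogonal_singleton_iff_inner_right.symm

end TangentPlane

/-! ### The density has no normal component -/

section Tangential

variable {Ω : TopologicalSpace.Opens R3} {F : R3 → R3} {M : ℝ} {μ : VectorMeasure R3 R3}
  {V S W : Set R3} {e : R3 ≃L[ℝ] E2 × ℝ} {g : E2 → ℝ} {K : ℝ≥0}

/-- `t` is a bounded density of the boundary pairing on `S`. -/
structure IsTraceDensity (V S : Set R3) (Ω : TopologicalSpace.Opens R3) (F : R3 → R3)
    (μ : VectorMeasure R3 R3) (t : R3 → R3) (C : ℝ) : Prop where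
  stronglyMeasurable : StronglyMeasurable t
  bound : ∀ᵐ x ∂(μHE[2] : Measure R3).restrict S, ‖t x‖ ≤ C
  integral_inner : ∀ Φ : 𝓓^{1}(Ω, R3), ∫ x in S, ⟪t x, Φ x⟫ ∂μHE[2] = boundaryForm V F μ Φ

/-- The normal field in a chart, extended constantly in the vertical direction. -/
noncomputable def chartNormal (e : R3 ≃L[ℝ] E2 × ℝ) (g : E2 → ℝ) (x : R3) : R3 :=
  slopeNormal e (fderiv ℝ g (e x).1)

lemma measurable_chartNormal (e : R3 ≃L[ℝ] E2 × ℝ) (g : E2 → ℝ) : Measurable (chartNormal e g) :=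
  (continuous_slopeNormal e).measurable.comp ((measurable_fderiv ℝ g).comp
    (continuous_fst.comp e.continuous).measurable)

lemma IsTraceDensity.integrable_inner {t : R3 → R3} {C : ℝ} (ht : IsTraceDensity V S Ω F μ t C)
    {Ψ : R3 → R3} (hΨ : IntegrableOn Ψ S (μHE[2] : Measure R3)) :
    IntegrableOn (fun x ↦ ⟪t x, Ψ x⟫) S (μHE[2] : Measure R3) := by
  refine Integrable.mono' (hΨ.norm.const_mul C)
    (ht.stronglyMeasurable.aestronglyMeasurable.inner hΨ.aestronglyMeasurable) ?_
  filter_upwards [ht.bound] with x hx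
  exact (norm_inner_le_norm _ _).trans (by gcongr)

lemma IsTraceDensity.abs_integral_inner_le {t : R3 → R3} {C : ℝ}
    (ht : IsTraceDensity V S Ω F μ t C)
    {Ψ : R3 → R3} (hΨ : IntegrableOn Ψ S (μHE[2] : Measure R3)) :
    |∫ x in S, ⟪t x, Ψ x⟫ ∂μHE[2]| ≤ C * ∫ x in S, ‖Ψ x‖ ∂μHE[2] := by
  rw [← Real.norm_eq_abs, ← integral_const_mul]
  refine norm_integral_le_of_norm_le (hΨ.norm.const_mul C) ?_
  filter_upwards [ht.bound] with x hx
  exact (norm_inner_le_norm _ _).trans (by gcongr)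

/-- The density annihilates fields that are normal to the surface. -/
lemma IsLipschitzSide.integral_inner_normal_eq_zero (h : IsLipschitzSide Ω V S)
    (hμ : HasCurlMeasure Ω F μ) (hF : BoundedOn Ω F M) (hM : 0 ≤ M)
    (hW : IsLocalGraph V S W e g K) {t : R3 → R3} {C : ℝ} (ht : IsTraceDensity V S Ω F μ t C)
    {θ : R3 → ℝ} (hθ : ContDiff ℝ 1 θ) (hθΩ : tsupport θ ⊆ Ω) (hθW : tsupport θ ⊆ W)
    (hθ1 : ∀ x, θ x ∈ Icc (0 : ℝ) 1) {Ψ : R3 → R3} (hΨ : IntegrableOn Ψ S (μHE[2] : Measure R3))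
    (hn : ∀ x, cross (chartNormal e g x) (Ψ x) = 0) :
    ∫ x in S, ⟪t x, θ x • Ψ x⟫ ∂μHE[2] = 0 := by
  have := h.isFiniteMeasure
  obtain ⟨N, hN0, hN⟩ := hW.exists_norm_slopeNormal_fderiv_le
  -- `|C|` pays for replacing `Ψ` by a smooth approximation in the integral, the other summand for
  -- the pairing with that approximation. The absolute value is needed because `C` carries no sign.
  set D := |C| + M * (transitionMass * (‖crossL‖ * N))
  have hθn : ∀ x (v : R3), ‖θ x • v‖ ≤ ‖v‖ := fun x v ↦ by
    rw [norm_smul, Real.norm_of_nonneg (hθ1 x).1]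
    exact mul_le_of_le_one_left (norm_nonneg _) (hθ1 x).2
  suffices hε : ∀ ε > 0, |∫ x in S, ⟪t x, θ x • Ψ x⟫ ∂μHE[2]| ≤ D * ε by
    have hD : Tendsto (fun ε : ℝ ↦ D * ε) (𝓝[>] 0) (𝓝 0) := by
      have : Tendsto (fun ε : ℝ ↦ D * ε) (𝓝 0) (𝓝 (D * 0)) := tendsto_id.const_mul D
      rw [mul_zero] at this
      exact this.mono_left nhdsWithin_le_nhds
    exact abs_nonpos_iff.1 (ge_of_tendsto hD (eventually_mem_nhdsWithin.mono hε))
  intro ε hε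
  obtain ⟨u, huc, hu, hΨu⟩ := (memLp_one_iff_integrable.2 hΨ).exist_eLpNorm_sub_le (by simp) le_rfl hε
  have huI : IntegrableOn u S (μHE[2] : Measure R3) := h.integrable hu.continuous
  have hdiff : IntegrableOn (fun x ↦ Ψ x - u x) S (μHE[2] : Measure R3) := hΨ.sub huI
  have hle : ∫ x in S, ‖Ψ x - u x‖ ∂μHE[2] ≤ ε := by
    rw [eLpNorm_one_eq_lintegral_enorm] at hΨu
    rw [integral_norm_eq_lintegral_enorm hdiff.aestronglyMeasurable]
    exact ENNReal.toReal_le_of_le_ofReal hε.le hΨu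
  have hsm : ∀ {f : R3 → R3}, IntegrableOn f S (μHE[2] : Measure R3) →
      IntegrableOn (fun x ↦ θ x • f x) S (μHE[2] : Measure R3) := fun {f} hf ↦
    Integrable.mono hf (hθ.continuous.aestronglyMeasurable.fun_smul hf.aestronglyMeasurable)
      (.of_forall fun x ↦ hθn x _)
  let Φ : 𝓓^{1}(Ω, R3) := cutoffTest hθ hθΩ (hu.of_le (by exact_mod_cast le_top)) huc
  have hΦ : ∀ x, Φ x = θ x • u x := fun x ↦ rfl
  have hΦW : tsupport Φ ⊆ W := (tsupport_cutoffTest_subset _ _ _ _).trans hθW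
  have h1 : |∫ x in S, ⟪t x, θ x • u x⟫ ∂μHE[2]| ≤ M * (transitionMass * (‖crossL‖ * N)) * ε := by
    have h2 := h.abs_boundaryForm_le_tangential hμ hF hM hW Φ hΦW
    rw [← ht.integral_inner] at h2
    refine h2.trans ?_
    have h3 : ∫ p in graphMap e g ⁻¹' W,
        ‖cross (slopeNormal e (fderiv ℝ g p)) (Φ (graphMap e g p))‖ ≤ (‖crossL‖ * N) * ε := by
      refine le_trans ?_ (mul_le_mul_of_nonneg_left ((hW.setIntegral_comp_graphMap_le hdiff.norm
        fun x ↦ norm_nonneg _).trans hle) (by positivity))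
      rw [← integral_const_mul]
      refine integral_mono_of_nonneg (.of_forall fun p ↦ norm_nonneg _)
        ((hW.integrableOn_comp_graphMap hdiff.norm).const_mul _) (.of_forall fun p ↦ ?_)
      -- Since `Ψ` is normal, the tangential part of the approximation `u` equals that of `u - Ψ`,
      -- which is small in L¹.
      have h4 : crossL (slopeNormal e (fderiv ℝ g p)) (Ψ (graphMap e g p)) = 0 := by
        simpa [chartNormal, crossL_apply] using hn (graphMap e g p)
      have h5 : cross (slopeNormal e (fderiv ℝ g p)) (Φ (graphMap e g p)) =
          - (θ (graphMap e g p) • cross (slopeNormal e (fderiv ℝ g p))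
            (Ψ (graphMap e g p) - u (graphMap e g p))) := by
        rw [hΦ, cross_smul_right, ← crossL_apply, ← crossL_apply, map_sub, h4]
        simp
      simp only [h5, norm_neg]
      refine (hθn _ _).trans ((norm_cross_le _ _).trans ?_)
      gcongr
      exact hN p
    exact (mul_le_mul_of_nonneg_left (mul_le_mul_of_nonneg_left h3 transitionMass_nonneg)
      hM).trans_eq (by ring)
  have h6 : |∫ x in S, ⟪t x, θ x • (Ψ x - u x)⟫ ∂μHE[2]| ≤ |C| * ε := by
    refine (ht.abs_integral_inner_le (hsm hdiff)).trans ?_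
    have h7 : ∫ x in S, ‖θ x • (Ψ x - u x)‖ ∂μHE[2] ≤ ε :=
      (integral_mono (hsm hdiff).norm hdiff.norm fun x ↦ hθn x _).trans hle
    exact mul_le_mul (le_abs_self C) h7 (integral_nonneg fun x ↦ norm_nonneg _) (abs_nonneg C)
  have h8 : ∫ x in S, ⟪t x, θ x • Ψ x⟫ ∂μHE[2] = ∫ x in S, ⟪t x, θ x • (Ψ x - u x)⟫ ∂μHE[2] +
      ∫ x in S, ⟪t x, θ x • u x⟫ ∂μHE[2] := by
    rw [← integral_add (ht.integrable_inner (hsm hdiff)) (ht.integrable_inner (hsm huI))]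
    refine integral_congr_ae (.of_forall fun x ↦ ?_)
    simp only [← inner_add_right, ← smul_add, sub_add_cancel]
  rw [h8, add_mul]
  exact (abs_add_le _ _).trans (add_le_add h6 h1)

/-- The density is tangential in a chart. -/
lemma IsLipschitzSide.ae_inner_chartNormal_eq_zero (h : IsLipschitzSide Ω V S)
    (hμ : HasCurlMeasure Ω F μ) (hF : BoundedOn Ω F M) (hM : 0 ≤ M)
    (hW : IsLocalGraph V S W e g K) {t : R3 → R3} {C : ℝ} (ht : IsTraceDensity V S Ω F μ t C) :
    ∀ᵐ x ∂(μHE[2] : Measure R3), x ∈ S → x ∈ W → ⟪chartNormal e g x, t x⟫ = 0 := by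
  have := h.isFiniteMeasure
  obtain ⟨N, hN0, hN⟩ := hW.exists_norm_slopeNormal_fderiv_le
  have hnm := measurable_chartNormal e g
  have htm := ht.stronglyMeasurable
  let Ψ : R3 → R3 := fun x ↦ ⟪chartNormal e g x, t x⟫ • chartNormal e g x
  have hΨ : IntegrableOn Ψ S (μHE[2] : Measure R3) := by
    refine Integrable.of_bound (C := N * C * N)
      ((hnm.aestronglyMeasurable.inner htm.aestronglyMeasurable).fun_smul
        hnm.aestronglyMeasurable) ?_
    filter_upwards [ht.bound] with x hx
    rw [norm_smul]
    have h1 : ‖chartNormal e g x‖ ≤ N := hN _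
    have h2 : ‖⟪chartNormal e g x, t x⟫‖ ≤ N * C :=
      (norm_inner_le_norm _ _).trans (by gcongr)
    exact mul_le_mul h2 h1 (norm_nonneg _) ((norm_nonneg _).trans h2)
  have hn : ∀ x, cross (chartNormal e g x) (Ψ x) = 0 := fun x ↦ by
    rw [cross_smul_right, cross_self, smul_zero]
  refine measure_null_of_locally_null _ fun x hx ↦ ?_
  have hx' : ¬ (x ∈ S → x ∈ W → ⟪chartNormal e g x, t x⟫ = 0) := hx
  push Not at hx'
  obtain ⟨hxS, hxW, -⟩ := hx'
  obtain ⟨θ, hθ, hθs, hθx, hθ1⟩ := exists_contDiff_cutoff (isClosed_singleton (x := x))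
    (hW.isOpen.inter Ω.isOpen) (singleton_subset_iff.2 ⟨hxW, h.surface_subset hxS⟩)
  rw [nhdsSet_singleton] at hθx
  have h0 := h.integral_inner_normal_eq_zero hμ hF hM hW ht hθ (hθs.trans inter_subset_right)
    (hθs.trans inter_subset_left) hθ1 hΨ hn
  -- With `Ψ` the multiple ⟨n, t⟩ n of the normal n, the integrand is non-negative, so its zero
  -- integral forces ⟨n, t⟩ = 0 where `θ = 1`.
  have hval : ∀ y, ⟪t y, θ y • Ψ y⟫ = θ y * ⟪chartNormal e g y, t y⟫ ^ 2 := fun y ↦ by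
    simp only [Ψ, inner_smul_right, real_inner_comm (t y)]
    ring
  have hint : IntegrableOn (fun y ↦ ⟪t y, θ y • Ψ y⟫) S (μHE[2] : Measure R3) := by
    refine ht.integrable_inner (Integrable.mono hΨ
      (hθ.continuous.aestronglyMeasurable.fun_smul hΨ.aestronglyMeasurable) (.of_forall fun y ↦ ?_))
    rw [norm_smul, Real.norm_of_nonneg (hθ1 y).1]
    exact mul_le_of_le_one_left (norm_nonneg _) (hθ1 y).2
  simp only [hval] at h0 hint
  have hae := (setIntegral_eq_zero_iff_of_nonneg_ae
    (.of_forall fun y ↦ mul_nonneg (hθ1 y).1 (sq_nonneg _)) hint).1 h0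
  rw [EventuallyEq, ae_restrict_iff' h.isCompact.measurableSet] at hae
  refine ⟨_, inter_mem self_mem_nhdsWithin (mem_nhdsWithin_of_mem_nhds hθx),
    measure_mono_null (fun y hy ↦ ?_) hae⟩
  obtain ⟨hyB, hyθ⟩ := hy
  have hyB' : ¬ (y ∈ S → y ∈ W → ⟪chartNormal e g y, t y⟫ = 0) := hyB
  have hyθ' : θ y = 1 := hyθ
  push Not at hyB'
  intro hy0
  have := hy0 hyB'.1
  rw [hyθ'] at this
  simp [hyB'.2.2] at this

end Tangential

/-! ### Volume preserving coordinates -/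

section Coordinates

/-- The splitting of `R3` into horizontal and vertical coordinates. -/
noncomputable def splitLast : R3 ≃L[ℝ] E2 × ℝ :=
  LinearEquiv.toContinuousLinearEquiv
    { toFun := fun x ↦ (!₂[x 0, x 1], x 2)
      invFun := fun p ↦ !₂[p.1 0, p.1 1, p.2]
      map_add' := fun x y ↦ Prod.ext (by ext i; fin_cases i <;> simp) (by simp)
      map_smul' := fun c x ↦ Prod.ext (by ext i; fin_cases i <;> simp) (by simp)
      left_inv := fun x ↦ by ext i; fin_cases i <;> simp
      right_inv := fun p ↦ Prod.ext (by ext i; fin_cases i <;> simp) (by simp) }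

lemma measurePreserving_splitLast : MeasurePreserving splitLast volume volume := by
  have h1 : MeasurePreserving (WithLp.ofLp : R3 → Fin 3 → ℝ) := PiLp.volume_preserving_ofLp (Fin 3)
  have h2 := volume_preserving_piFinSuccAbove (fun _ : Fin 3 ↦ ℝ) 2
  have h3 : MeasurePreserving (Prod.swap : ℝ × (Fin 2 → ℝ) → (Fin 2 → ℝ) × ℝ) :=
    Measure.measurePreserving_swap
  have h4 : MeasurePreserving (Prod.map (WithLp.toLp 2) id : (Fin 2 → ℝ) × ℝ → E2 × ℝ) :=
    (PiLp.volume_preserving_toLp (Fin 2)).prod (MeasurePreserving.id volume)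
  have h5 : ⇑splitLast = Prod.map (WithLp.toLp 2) id ∘ Prod.swap ∘
      MeasurableEquiv.piFinSuccAbove (fun _ : Fin 3 ↦ ℝ) 2 ∘ WithLp.ofLp := by
    funext x
    refine Prod.ext ?_ rfl
    ext i
    fin_cases i <;> rfl
  rw [h5]
  exact h4.comp (h3.comp (h2.comp h1))

/-- Cartesian coordinates after the rotation `R`. -/
noncomputable def rotatedSplit (R : R3 ≃ₗᵢ[ℝ] R3) : R3 ≃L[ℝ] E2 × ℝ :=
  R.toContinuousLinearEquiv.trans splitLast

lemma rotatedSplit_apply (R : R3 ≃ₗᵢ[ℝ] R3) (x : R3) :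
    rotatedSplit R x = (!₂[R x 0, R x 1], R x 2) := rfl

lemma measurePreserving_rotatedSplit (R : R3 ≃ₗᵢ[ℝ] R3) :
    MeasurePreserving (rotatedSplit R) volume volume :=
  measurePreserving_splitLast.comp R.measurePreserving

lemma norm_rotatedSplit_fst_le (R : R3 ≃ₗᵢ[ℝ] R3) (x : R3) : ‖(rotatedSplit R x).1‖ ≤ ‖x‖ := by
  rw [← R.norm_map x, rotatedSplit_apply]
  refine le_of_sq_le_sq ?_ (norm_nonneg _)
  rw [EuclideanSpace.real_norm_sq_eq, EuclideanSpace.real_norm_sq_eq]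
  simp [Fin.sum_univ_succ]
  nlinarith [sq_nonneg (R x 2)]

/-- The coordinates obtained by reversing the vertical axis. -/
noncomputable def flipVertical (e : R3 ≃L[ℝ] E2 × ℝ) : R3 ≃L[ℝ] E2 × ℝ :=
  e.trans ((ContinuousLinearEquiv.refl ℝ E2).prodCongr (ContinuousLinearEquiv.neg ℝ))

lemma flipVertical_apply (e : R3 ≃L[ℝ] E2 × ℝ) (x : R3) :
    flipVertical e x = ((e x).1, -(e x).2) := rfl

/-- The exterior is locally a strict subgraph; reversing the vertical axis lets it share the
estimates for supergraphs. -/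
lemma IsLocalGraph.flip {V V' S W : Set R3} {e : R3 ≃L[ℝ] E2 × ℝ} {g : E2 → ℝ} {K : ℝ≥0}
    (h : IsLocalGraph V S W e g K) (hV' : ∀ x ∈ W, x ∈ V' ↔ (e x).2 < g (e x).1) :
    IsLocalGraph V' S W (flipVertical e) (-g) K where
  measurePreserving := ((MeasurePreserving.id volume).prod
    (Measure.measurePreserving_neg volume)).comp h.measurePreserving
  norm_fst_le := h.norm_fst_le
  lipschitz := h.lipschitz.neg
  isOpen := h.isOpen
  isBounded := h.isBounded
  mem_iff x hx := by simp [flipVertical_apply, hV' x hx]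
  mem_surface_iff x hx := by simp [flipVertical_apply, h.mem_surface_iff x hx]

end Coordinates

/-! ### The two sides of a Lipschitz boundary -/

section LipschitzDomain

/-- A point of the graph is a limit of points vertically above it, and points strictly below have a
neighbourhood missing `U`. This identifies the frontier with the graph and the complement of the
closure with the strict subgraph. -/
lemma mem_closure_iff_of_graph {U W : Set R3} {e : R3 ≃L[ℝ] E2 × ℝ} {g : E2 → ℝ}
    (hg : Continuous g) (hW : IsOpen W) (h : ∀ x ∈ W, x ∈ U ↔ g (e x).1 < (e x).2) {x : R3}
    (hx : x ∈ W) : x ∈ closure U ↔ g (e x).1 ≤ (e x).2 := by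
  refine ⟨fun hxU ↦ ?_, fun hle ↦ ?_⟩
  · by_contra! hlt
    have hopen : IsOpen {y | (e y).2 < g (e y).1} := isOpen_lt (by fun_prop) (by fun_prop)
    obtain ⟨y, ⟨hyW, hy⟩, hyU⟩ := mem_closure_iff.1 hxU _ (hW.inter hopen) ⟨hx, hlt⟩
    exact lt_asymm hy ((h y hyW).1 hyU)
  · have hlim : Tendsto (fun t : ℝ ↦ x + t • e.symm (0, 1)) (𝓝[>] 0) (𝓝 x) := by
      have : Continuous fun t : ℝ ↦ x + t • e.symm (0, 1) := by fun_prop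
      simpa using (this.tendsto 0).mono_left nhdsWithin_le_nhds
    refine mem_closure_of_tendsto hlim ?_
    filter_upwards [hlim (hW.mem_nhds hx), self_mem_nhdsWithin] with t ht ht0
    rw [h _ ht]
    have ht0' : (0 : ℝ) < t := ht0
    simp only [map_add, map_smul, ContinuousLinearEquiv.apply_symm_apply, Prod.fst_add,
      Prod.smul_fst, smul_zero, add_zero, Prod.snd_add, Prod.smul_snd, smul_eq_mul, mul_one]
    linarith

lemma HasLipschitzBoundary.exists_chart {U : Set R3} (hU : HasLipschitzBoundary U)
    (hUo : IsOpen U) {N : Set R3} (hN : IsOpen N) {x : R3} (hx : x ∈ frontier U) (hxN : x ∈ N) :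
    ∃ W ⊆ N, ∃ e g K, x ∈ W ∧ IsLocalGraph U (frontier U) W e g K ∧
      ∀ y ∈ W, y ∉ closure U ↔ (e y).2 < g (e y).1 := by
  obtain ⟨R, g, K, hg, hev⟩ := hU x hx
  obtain ⟨r, hr, hball⟩ := Metric.eventually_nhds_iff_ball.1 (hev.and (hN.mem_nhds hxN))
  have hcl : ∀ y ∈ Metric.ball x r, y ∈ closure U ↔
      g (rotatedSplit R y).1 ≤ (rotatedSplit R y).2 := fun y hy ↦
    mem_closure_iff_of_graph hg.continuous Metric.isOpen_ball (fun z hz ↦ (hball z hz).1) hy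
  refine ⟨Metric.ball x r, fun y hy ↦ (hball y hy).2, rotatedSplit R, g, K,
    Metric.mem_ball_self hr, ?_, fun y hy ↦ by rw [hcl y hy, not_le]⟩
  exact
    { measurePreserving := measurePreserving_rotatedSplit R
      norm_fst_le := norm_rotatedSplit_fst_le R
      lipschitz := hg
      isOpen := Metric.isOpen_ball
      isBounded := Metric.isBounded_ball
      mem_iff := fun y hy ↦ (hball y hy).1
      mem_surface_iff := fun y hy ↦ by
        rw [hUo.frontier_eq, Set.mem_sdiff, hcl y hy, (hball y hy).1]
        exact ⟨fun h ↦ le_antisymm (not_lt.1 h.2) h.1, fun h ↦ ⟨h.ge, h.le.not_gt⟩⟩ }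

variable {Ω : TopologicalSpace.Opens R3} {U : Set R3}

lemma HasLipschitzBoundary.isLipschitzSide (hU : HasLipschitzBoundary U)
    (hΩ : Bornology.IsBounded (Ω : Set R3)) (hUo : IsOpen U) (hUΩ : closure U ⊆ Ω) :
    IsLipschitzSide Ω U (frontier U) where
  isOpen := hUo
  subset := subset_closure.trans hUΩ
  isCompact := Metric.isCompact_of_isClosed_isBounded isClosed_frontier
    (hΩ.subset (frontier_subset_closure.trans hUΩ))
  surface_subset := frontier_subset_closure.trans hUΩ
  frontier_subset := inter_subset_left
  exists_chart x hx := by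
    obtain ⟨W, -, e, g, K, hxW, hW, -⟩ := hU.exists_chart hUo isOpen_univ hx trivial
    exact ⟨W, e, g, K, hxW, hW⟩

lemma HasLipschitzBoundary.isLipschitzSide_exterior (hU : HasLipschitzBoundary U)
    (hΩ : Bornology.IsBounded (Ω : Set R3)) (hUo : IsOpen U) (hUΩ : closure U ⊆ Ω) :
    IsLipschitzSide Ω (Ω \ closure U) (frontier U) where
  isOpen := Ω.isOpen.sdiff isClosed_closure
  subset := sdiff_subset
  isCompact := (hU.isLipschitzSide hΩ hUo hUΩ).isCompact
  surface_subset := (hU.isLipschitzSide hΩ hUo hUΩ).surface_subset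
  frontier_subset := by
    rintro x ⟨hx, hxΩ⟩
    rw [(Ω.isOpen.sdiff isClosed_closure).frontier_eq] at hx
    have hxcl : x ∈ closure U := by
      by_contra h
      exact hx.2 ⟨hxΩ, h⟩
    rw [hUo.frontier_eq]
    refine ⟨hxcl, fun hxU ↦ ?_⟩
    obtain ⟨y, hyU, -, hy⟩ := mem_closure_iff.1 hx.1 U hUo hxU
    exact hy (subset_closure hyU)
  exists_chart x hx := by
    -- The chart is taken inside `Ω`, so that in it lying in `Ω \ closure U` means lying outside
    -- `closure U`.
    obtain ⟨W, hWΩ, e, g, K, hxW, hW, hext⟩ := hU.exists_chart hUo Ω.isOpen hx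
      (hUΩ (frontier_subset_closure hx))
    refine ⟨W, _, _, K, hxW, hW.flip fun y hy ↦ ?_⟩
    rw [← hext y hy, Set.mem_sdiff]
    exact and_iff_right (hWΩ hy)

end LipschitzDomain

/-! ### Scalar traces and assembly -/

section Assembly

variable {Ω : TopologicalSpace.Opens R3} {F : R3 → R3} {M : ℝ} {μ : VectorMeasure R3 R3}
  {V S : Set R3} {t : R3 → R3} {C : ℝ}

lemma exists_boundedOn (hF : MemLp F ∞ (volume.restrict (Ω : Set R3))) :
    ∃ M, 0 ≤ M ∧ BoundedOn Ω F M := by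
  refine ⟨(eLpNormEssSup F (volume.restrict (Ω : Set R3))).toReal, ENNReal.toReal_nonneg, hF.1, ?_⟩
  have hfin : eLpNormEssSup F (volume.restrict (Ω : Set R3)) ≠ ∞ := by
    rw [← eLpNorm_exponent_top]; exact hF.2.ne
  filter_upwards [ae_le_eLpNormEssSup (f := F) (μ := volume.restrict (Ω : Set R3))] with x hx
  rw [← toReal_enorm]
  exact ENNReal.toReal_mono hfin hx

lemma IsLipschitzSide.exists_isTraceDensity (h : IsLipschitzSide Ω V S)
    (hμ : HasCurlMeasure Ω F μ) (hF : BoundedOn Ω F M) (hM : 0 ≤ M) :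
    ∃ t C, IsTraceDensity V S Ω F μ t C := by
  obtain ⟨t, ht, ⟨C, hC⟩, hint⟩ := h.exists_density hμ hF hM
  exact ⟨t, C, ht, hC, hint⟩

lemma IsTraceDensity.memLp (ht : IsTraceDensity V S Ω F μ t C) :
    MemLp t ∞ (μHE[2].restrict S) :=
  memLp_top_of_bound ht.stronglyMeasurable.aestronglyMeasurable C ht.bound

/-- The product of a scalar test function and a constant vector. -/
noncomputable def constTest {E : Type*} [NormedAddCommGroup E] [NormedSpace ℝ E]
    (φ : 𝓓^{1}(Ω, ℝ)) (c : E) : 𝓓^{1}(Ω, E) where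
  toFun x := φ x • c
  contDiff' := φ.contDiff.smul contDiff_const
  hasCompactSupport' := φ.hasCompactSupport.smul_right
  tsupport_subset' := (tsupport_smul_subset_left φ fun _ ↦ c).trans φ.tsupport_subset

lemma inner_setIntegral_vectorMeasure [IsFiniteMeasure μ.variation] (V : Set R3)
    (φ : 𝓓^{1}(Ω, ℝ)) (c : R3) :
    ⟪c, ∫ᵛ x in V, φ x ∂•μ⟫ = ∫ᵛ x in V, φ x • c ∂[innerB; μ] := by
  have hφ := (integrable_vectorMeasure φ.continuous φ.hasCompactSupport μ).restrict (s := V)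
  have h1 := VectorMeasure.continuousLinearMap_apply_integral (C := innerSL ℝ c)
    (B := ContinuousLinearMap.lsmul ℝ ℝ) hφ
  have h2 := VectorMeasure.integral_continuousLinearMap_comp (B := innerB)
    (C := (ContinuousLinearMap.id ℝ ℝ).smulRight c) hφ
  simp only [ContinuousLinearMap.smulRight_apply, ContinuousLinearMap.id_apply] at h2
  rw [h2]
  refine h1.trans ?_
  congr 1
  ext
  simp [innerB]
  rfl

lemma integrable_cross_gradient (hF : BoundedOn V F M) (φ : 𝓓^{1}(Ω, ℝ)) :
    IntegrableOn (fun x ↦ cross (F x) (gradient φ x)) V := by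
  have hc : Continuous (gradient φ) :=
    (InnerProductSpace.toDual ℝ R3).symm.continuous.comp
      (φ.contDiff.continuous_fderiv one_ne_zero)
  have hs : HasCompactSupport (gradient φ) :=
    (φ.hasCompactSupport.fderiv ℝ).comp_left (map_zero (InnerProductSpace.toDual ℝ R3).symm)
  refine Integrable.mono' ((hc.integrable_of_hasCompactSupport hs).norm.integrableOn.const_mul
    (‖crossL‖ * M)) ?_ ?_
  · simp only [← crossL_apply]
    exact crossL.aestronglyMeasurable_comp₂ hF.aestronglyMeasurable hc.aestronglyMeasurable
  filter_upwards [hF.bound] with x hx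
  exact (norm_cross_le _ _).trans (by gcongr)

/-- By cyclic invariance of the triple product, (∇φ × c) · F = c · (F × ∇φ), and ∇φ × c is the curl
of φc. -/
lemma inner_scalarTrace (hμ : HasCurlMeasure Ω F μ) (hF : BoundedOn V F M) (φ : 𝓓^{1}(Ω, ℝ))
    (c : R3) : ⟪c, (∫ᵛ x in V, φ x ∂•μ) - ∫ x in V, cross (F x) (gradient φ x)⟫ =
      boundaryForm V F μ (constTest φ c) := by
  have := hμ.finite_variation
  have hcurl : ∀ x, ⟪curl (constTest φ c) x, F x⟫ = ⟪c, cross (F x) (gradient φ x)⟫ := fun x ↦ by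
    rw [← inner_cross_left, ← curl_smul_const (φ.contDiff.differentiable one_ne_zero x)]
    rfl
  rw [inner_sub_right, inner_setIntegral_vectorMeasure, boundaryForm,
    ← integral_inner (integrable_cross_gradient hF φ)]
  simp only [hcurl]
  rfl

lemma IsTraceDensity.integral_smul (ht : IsTraceDensity V S Ω F μ t C) (h : IsLipschitzSide Ω V S)
    (hμ : HasCurlMeasure Ω F μ) (hF : BoundedOn Ω F M) (φ : 𝓓^{1}(Ω, ℝ)) :
    ∫ x in S, φ x • t x ∂μHE[2] =
      (∫ᵛ x in V, φ x ∂•μ) - ∫ x in V, cross (F x) (gradient φ x) := by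
  refine ext_inner_left ℝ fun c ↦ ?_
  have hint : IntegrableOn (fun x ↦ φ x • t x) S (μHE[2] : Measure R3) := by
    refine Integrable.mono' ((h.integrable φ.continuous).norm.mul_const C)
      (φ.continuous.aestronglyMeasurable.fun_smul ht.stronglyMeasurable.aestronglyMeasurable) ?_
    filter_upwards [ht.bound] with x hx
    rw [norm_smul]
    gcongr
  rw [inner_scalarTrace hμ (hF.mono h.subset), ← ht.integral_inner, ← _root_.integral_inner hint]
  refine integral_congr_ae (.of_forall fun x ↦ ?_)
  change ⟪c, φ x • t x⟫ = ⟪t x, φ x • c⟫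
  rw [inner_smul_right, inner_smul_right, real_inner_comm]

/-- The trace density lies in the tangent plane almost everywhere. -/
lemma IsLipschitzSide.ae_mem_tangentPlane (h : IsLipschitzSide Ω V S) (hμ : HasCurlMeasure Ω F μ)
    (hF : BoundedOn Ω F M) (hM : 0 ≤ M) (ht : IsTraceDensity V S Ω F μ t C) :
    ∀ᵐ x ∂(μHE[2] : Measure R3).restrict S, ∃ T, IsTangentPlane S x T ∧ t x ∈ T := by
  rw [ae_restrict_iff' h.isCompact.measurableSet]
  refine measure_null_of_locally_null _ fun x hx ↦ ?_
  have hx' : ¬ (x ∈ S → ∃ T, IsTangentPlane S x T ∧ t x ∈ T) := hx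
  obtain ⟨W, e, g, K, hxW, hW⟩ := h.exists_chart x (Classical.not_imp.1 hx').1
  have hae : ∀ᵐ y ∂(μHE[2] : Measure R3), y ∈ W → y ∈ S → ∃ T, IsTangentPlane S y T ∧ t y ∈ T := by
    filter_upwards [hW.ae_of_ae_fst hW.lipschitz.ae_differentiableAt,
      h.ae_inner_chartNormal_eq_zero hμ hF hM hW ht] with y hy1 hy2 hyW hyS
    exact ⟨_, hW.isTangentPlane hyS hyW (hy1 hyS hyW),
      Submodule.mem_orthogonal_singleton_iff_inner_right.2 (hy2 hyS hyW)⟩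
  refine ⟨_, inter_mem (mem_nhdsWithin_of_mem_nhds (hW.isOpen.mem_nhds hxW))
    self_mem_nhdsWithin, measure_mono_null (fun y hy ↦ ?_) hae⟩
  exact fun hy' ↦ hy.2 (hy' hy.1)

/-- Uniqueness lets the interior and exterior densities, obtained separately, be placed in one
common plane. -/
lemma IsTangentPlane.eq {x : R3} {T T' : Submodule ℝ R3} (h : IsTangentPlane S x T)
    (h' : IsTangentPlane S x T') : T = T' :=
  SetLike.coe_injective (h.2.symm.trans h'.2)

end Assembly

end CurlMeasure

theorem mainTheorem1
    (Ω : TopologicalSpace.Opens CurlMeasure.R3)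
    (hΩ : Bornology.IsBounded (Ω : Set CurlMeasure.R3))
    (Ω' : Set CurlMeasure.R3) (hΩ'_open : IsOpen Ω')
    (hΩ'_sub : closure Ω' ⊆ (Ω : Set CurlMeasure.R3))
    (hΩ'_lip : CurlMeasure.HasLipschitzBoundary Ω')
    (F : CurlMeasure.R3 → CurlMeasure.R3)
    (hF : CurlMeasure.IsCurlMeasureField ∞ Ω F)
    (curlF : VectorMeasure CurlMeasure.R3 CurlMeasure.R3)
    (hcurlF : CurlMeasure.HasCurlMeasure Ω F curlF) :
    ∃ tInt tExt : CurlMeasure.R3 → CurlMeasure.R3,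
      -- the densities are essentially bounded on the boundary
      MemLp tInt ∞ (μHE[2].restrict (frontier Ω')) ∧
      MemLp tExt ∞ (μHE[2].restrict (frontier Ω')) ∧
      -- they represent the interior and exterior distributional tangential traces
      (∀ φ : 𝓓^{1}(Ω, ℝ),
        ∫ x in frontier Ω', φ x • tInt x ∂μHE[2] = CurlMeasure.interiorTrace Ω' F curlF φ ∧
        ∫ x in frontier Ω', φ x • tExt x ∂μHE[2] = CurlMeasure.exteriorTrace Ω Ω' F curlF φ) ∧
      -- they are tangential almost everywhere
      (∀ᵐ x ∂(μHE[2].restrict (frontier Ω')), ∃ T : Submodule ℝ CurlMeasure.R3,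
        CurlMeasure.IsTangentPlane (frontier Ω') x T ∧ tInt x ∈ T ∧ tExt x ∈ T) ∧
      -- vectorial integration by parts
      (∀ Φ : 𝓓^{1}(Ω, CurlMeasure.R3),
        ∫ x in frontier Ω', ⟪tInt x, Φ x⟫ ∂μHE[2] =
          (∫ᵛ x in Ω', Φ x ∂[CurlMeasure.innerB; curlF])
            - ∫ x in Ω', ⟪CurlMeasure.curl Φ x, F x⟫ ∧
        ∫ x in frontier Ω', ⟪tExt x, Φ x⟫ ∂μHE[2] =
          -(∫ᵛ x in (Ω : Set CurlMeasure.R3) \ closure Ω', Φ x ∂[CurlMeasure.innerB; curlF])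
            + ∫ x in (Ω : Set CurlMeasure.R3) \ closure Ω', ⟪CurlMeasure.curl Φ x, F x⟫) := by
  obtain ⟨M, hM, hFM⟩ := CurlMeasure.exists_boundedOn hF.1
  have hI := hΩ'_lip.isLipschitzSide hΩ hΩ'_open hΩ'_sub
  have hE := hΩ'_lip.isLipschitzSide_exterior hΩ hΩ'_open hΩ'_sub
  obtain ⟨tI, CI, htI⟩ := hI.exists_isTraceDensity hcurlF hFM hM
  obtain ⟨tE, CE, htE⟩ := hE.exists_isTraceDensity hcurlF hFM hM
  -- The exterior trace is minus the boundary pairing of the exterior side, hence the sign.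
  refine ⟨tI, fun x ↦ -tE x, htI.memLp, htE.memLp.neg, fun φ ↦ ⟨?_, ?_⟩, ?_, fun Φ ↦ ⟨?_, ?_⟩⟩
  · exact htI.integral_smul hI hcurlF hFM φ
  · simp only [smul_neg]
    rw [integral_neg, htE.integral_smul hE hcurlF hFM φ, CurlMeasure.exteriorTrace, neg_sub,
      sub_eq_neg_add]
  · filter_upwards [hI.ae_mem_tangentPlane hcurlF hFM hM htI,
      hE.ae_mem_tangentPlane hcurlF hFM hM htE] with x ⟨T, hT, hTI⟩ ⟨T', hT', hTE⟩
    exact ⟨T, hT, hTI, T.neg_mem (hT'.eq hT ▸ hTE)⟩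
  · exact htI.integral_inner Φ
  · simp only [inner_neg_left]
    rw [integral_neg, htE.integral_inner Φ, CurlMeasure.boundaryForm, neg_sub, sub_eq_neg_add]
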